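/- **Theorem.** Let $H$ be a finite-dimensional Hopf algebra over a field $k$ with counit $\epsilon$, and fix a left integral $\Lambda$ of $H$, i.e. an element $\Lambda \neq 0$ of $H$ with $h\Lambda=\epsilon(h)\Lambda$ for all $h\in H$. Let $A$ be a left $H$-comodule algebra: an associative unital $k$-algebra with a coassociative and counital coaction $\Delta_A: A\to H\otimes A$ that is a homomorphism of $k$-algebras (all tensor products are over $k$). For an $H$-module $V$ and a left $A$-module $M$, regard $V\otimes M$ as an $A$-module via $\Delta_A$. Call a morphism of $A$-modules null-homotopic if it factors through an $A$-module of the form $H\otimes N$, with $N$ an $A$-module, and let $A_H\text{-}\underline{\mathrm{mod}}$ be the quotient of the category of left $A$-modules by the ideal of null-homotopic morphisms. Put $T(M)=(H/k\Lambda)\otimes M$. For a morphism of $A$-modules $u: X\to Y$ let $C_u$ be the pushout of $u$ along the map $x: X\to H\otimes X$, $x(m)=\Lambda\otimes m$; let $v:Y\to C_u$ be the canonical map, and let $w: C_u\to T(X)$ be the map with $wv=0$ whose composite with $H\otimes X\to C_u$ is the quotient map $H\otimes X\to (H/k\Lambda)\otimes X$. Call a triangle in $A_H\text{-}\underline{\mathrm{mod}}$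 distinguished if it is isomorphic in $A_H\text{-}\underline{\mathrm{mod}}$ to the image of $X\xrightarrow{u}Y\xrightarrow{v}C_u\xrightarrow{w}T(X)$ for some morphism $u$ of $A$-modules. Then $T$ induces an additive self-equivalence of $A_H\text{-}\underline{\mathrm{mod}}$, and $A_H\text{-}\underline{\mathrm{mod}}$, with the shift functor $T$ and these distinguished triangles, is a triangulated category (the octahedral axiom included). -/

import Mathlib

noncomputable section

namespace Hopfological

open CategoryTheory CategoryTheory.Limits CategoryTheory.Pretriangulated TensorProduct
open scoped ModuleCat

universe u v u'

/-- A left integral of a Hopf algebra `H`: a nonzero `Λ` with `h Λ = ε(h) Λ` for all `h`. -/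
structure LeftIntegral (k : Type u) (H : Type v) [Field k] [Ring H] [HopfAlgebra k H] where
  elt : H
  ne_zero : elt ≠ 0
  mul_elt : ∀ h : H, h * elt = Coalgebra.counit (R := k) h • elt

/-- The line `kΛ`, which is a left ideal of `H`. -/
def LeftIntegral.line {k : Type u} {H : Type v} [Field k] [Ring H] [HopfAlgebra k H]
    (Λ : LeftIntegral k H) : Submodule H H where
  carrier := {x | ∃ c : k, x = c • Λ.elt}
  add_mem' := by
    rintro _ _ ⟨c, rfl⟩ ⟨d, rfl⟩
    exact ⟨c + d, (add_smul c d _).symm⟩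
  zero_mem' := ⟨0, (zero_smul k _).symm⟩
  smul_mem' := by
    rintro h _ ⟨c, rfl⟩
    refine ⟨c * Coalgebra.counit (R := k) h, ?_⟩
    rw [smul_eq_mul, mul_smul_comm, Λ.mul_elt, smul_smul]

/-- A left `H`-comodule algebra structure on a `k`-algebra `A`: a counital and coassociative
coaction `A → H ⊗ A` that is a homomorphism of `k`-algebras. -/
structure LeftComoduleAlgebra (k : Type u) (H : Type v) (A : Type u') [Field k] [Ring H]
    [HopfAlgebra k H] [Ring A] [Algebra k A] where
  coact : A →ₐ[k] H ⊗[k] A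
  counit_coact : ∀ a : A,
    TensorProduct.lid k A ((Coalgebra.counit (R := k) (A := H)).rTensor A (coact a)) = a
  coassoc : ∀ a : A,
    TensorProduct.assoc k H H A ((Coalgebra.comul (R := k) (A := H)).rTensor A (coact a)) =
      coact.toLinearMap.lTensor H (coact a)

section

variable {k : Type u} {H : Type v} {A : Type u'} [Field k] [Ring H] [HopfAlgebra k H]
  [Ring A] [Algebra k A] (δ : LeftComoduleAlgebra k H A)

section tensor

variable (V W : Type v) [AddCommGroup V] [Module k V] [Module H V] [IsScalarTower k H V]
  [AddCommGroup W] [Module k W] [Module H W] [IsScalarTower k H W]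
  (M N : Type v) [AddCommGroup M] [Module k M] [Module A M] [IsScalarTower k A M]
  [AddCommGroup N] [Module k N] [Module A N] [IsScalarTower k A N]

/-- The action of `A` on `V ⊗ M`, for `V` an `H`-module and `M` an `A`-module:
`A → H ⊗ A → End V ⊗ End M → End (V ⊗ M)`. -/
def tensorAction : A →ₐ[k] Module.End k (V ⊗[k] M) :=
  (Module.endTensorEndAlgHom (R := k) (S := k) (A := k) (M := V) (N := M)).comp
    ((Algebra.TensorProduct.map (Algebra.lsmul k k V) (Algebra.lsmul k k M)).comp δ.coact)

/-- The vector space `V ⊗ M`, to be regarded as an `A`-module through the coaction (and not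
through any action of `A` on the left factor, hence the type synonym). -/
def TensorObj (_ : LeftComoduleAlgebra k H A) (V M : Type v) [AddCommGroup V] [Module k V]
    [AddCommGroup M] [Module k M] : Type v := V ⊗[k] M

instance : AddCommGroup (TensorObj δ V M) := inferInstanceAs (AddCommGroup (V ⊗[k] M))

instance : Module A (TensorObj δ V M) :=
  Module.compHom (V ⊗[k] M) (tensorAction δ V M).toRingHom

variable {V W M N}

/-- The action of `h ⊗ a ∈ H ⊗ A` on `V ⊗ M` commutes with `φ ⊗ f` for `φ` an `H`-linear map
and `f` an `A`-linear map. -/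
lemma map_tensorAction (φ : V →ₗ[H] W) (f : M →ₗ[A] N) (a : A) (x : V ⊗[k] M) :
    TensorProduct.map (φ.restrictScalars k) (f.restrictScalars k) (tensorAction δ V M a x) =
      tensorAction δ W N a
        (TensorProduct.map (φ.restrictScalars k) (f.restrictScalars k) x) := by
  simp only [tensorAction, AlgHom.comp_apply]
  induction δ.coact a using TensorProduct.induction_on with
  | zero => simp
  | add y z hy hz => simp only [map_add, LinearMap.add_apply, hy, hz]
  | tmul h b =>
    induction x using TensorProduct.induction_on with
    | zero => simp
    | add y z hy hz => simp only [map_add, hy, hz]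
    | tmul v m => simp [Module.endTensorEndAlgHom_apply]

/-- The `A`-linear map `φ ⊗ f : V ⊗ M → W ⊗ N`. -/
def tensorMap (φ : V →ₗ[H] W) (f : M →ₗ[A] N) : TensorObj δ V M →ₗ[A] TensorObj δ W N where
  toFun := TensorProduct.map (φ.restrictScalars k) (f.restrictScalars k)
  map_add' := fun x y => map_add
    (TensorProduct.map (φ.restrictScalars k) (f.restrictScalars k)) x y
  map_smul' := fun a x => map_tensorAction δ φ f a x

/-- The `A`-linear map `M → H ⊗ M`, `m ↦ Λ ⊗ m`. -/
def integralMap (Λ : LeftIntegral k H) : M →ₗ[A] TensorObj δ H M where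
  toFun := fun m => (Λ.elt ⊗ₜ[k] m : H ⊗[k] M)
  map_add' := fun m n => TensorProduct.tmul_add Λ.elt m n
  map_smul' := by
    intro a m
    change (Λ.elt ⊗ₜ[k] (a • m) : H ⊗[k] M) = tensorAction δ H M a (Λ.elt ⊗ₜ[k] m)
    have key : ∀ y : H ⊗[k] A,
        (Λ.elt ⊗ₜ[k]
          ((TensorProduct.lid k A ((Coalgebra.counit (R := k) (A := H)).rTensor A y)) • m) :
            H ⊗[k] M) =
        Module.endTensorEndAlgHom (R := k) (S := k) (A := k) (M := H) (N := M)
          (Algebra.TensorProduct.map (Algebra.lsmul k k H) (Algebra.lsmul k k M) y)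
          (Λ.elt ⊗ₜ[k] m) := by
      intro y
      induction y using TensorProduct.induction_on with
      | zero => simp
      | add y z hy hz =>
        simp only [map_add, LinearMap.add_apply, ← hy, ← hz, add_smul, TensorProduct.tmul_add]
      | tmul h b => simp [Module.endTensorEndAlgHom_apply, Λ.mul_elt, TensorProduct.smul_tmul']
    have := key (δ.coact a)
    rwa [δ.counit_coact] at this

end tensor

/-- The functor `V ⊗ - : A-mod ⥤ A-mod`, for an `H`-module `V`. -/
def tensorFunctor (V : Type v) [AddCommGroup V] [Module k V] [Module H V]
    [IsScalarTower k H V] : ModuleCat.{v} A ⥤ ModuleCat.{v} A where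
  obj M := ModuleCat.of A (TensorObj δ V M)
  map f := ModuleCat.ofHom (tensorMap δ (LinearMap.id : V →ₗ[H] V) f.hom)
  map_id M := by
    ext x
    exact LinearMap.congr_fun (TensorProduct.map_id (R := k) (M := V) (N := M)) x
  map_comp {M N P} f g := by
    ext x
    exact LinearMap.congr_fun (TensorProduct.map_comp
      (LinearMap.id : V →ₗ[k] V) (g.hom.restrictScalars k)
      (LinearMap.id : V →ₗ[k] V) (f.hom.restrictScalars k)) x

instance (V : Type v) [AddCommGroup V] [Module k V] [Module H V] [IsScalarTower k H V] :
    (tensorFunctor δ V).Additive where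
  map_add {M N} f g := by
    ext x
    exact LinearMap.congr_fun (TensorProduct.map_add_right
      (LinearMap.id : V →ₗ[k] V) (f.hom.restrictScalars k) (g.hom.restrictScalars k)) x

/-- A morphism of `A`-modules is null-homotopic if it factors through some `H ⊗ N`. -/
def NullHomotopic {M₁ M₂ : ModuleCat.{v} A} (f : M₁ ⟶ M₂) : Prop :=
  ∃ (N : ModuleCat.{v} A) (g₁ : M₁ ⟶ (tensorFunctor δ H).obj N)
    (g₂ : (tensorFunctor δ H).obj N ⟶ M₂), g₁ ≫ g₂ = f

namespace NullHomotopic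

variable {δ} {M₁ M₂ M₃ : ModuleCat.{v} A}

lemma zero : NullHomotopic δ (0 : M₁ ⟶ M₂) := ⟨M₁, 0, 0, by simp⟩

lemma neg {f : M₁ ⟶ M₂} (hf : NullHomotopic δ f) : NullHomotopic δ (-f) := by
  obtain ⟨N, g₁, g₂, rfl⟩ := hf
  exact ⟨N, g₁, -g₂, by simp⟩

lemma add {f f' : M₁ ⟶ M₂} (hf : NullHomotopic δ f) (hf' : NullHomotopic δ f') :
    NullHomotopic δ (f + f') := by
  obtain ⟨N, g₁, g₂, rfl⟩ := hf
  obtain ⟨N', g₁', g₂', rfl⟩ := hf'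
  refine ⟨N ⊞ N', g₁ ≫ (tensorFunctor δ H).map biprod.inl +
      g₁' ≫ (tensorFunctor δ H).map biprod.inr,
    (tensorFunctor δ H).map biprod.fst ≫ g₂ + (tensorFunctor δ H).map biprod.snd ≫ g₂', ?_⟩
  simp [← Functor.map_comp_assoc]

lemma comp_left (f : M₁ ⟶ M₂) {g : M₂ ⟶ M₃} (hg : NullHomotopic δ g) :
    NullHomotopic δ (f ≫ g) := by
  obtain ⟨N, g₁, g₂, rfl⟩ := hg
  exact ⟨N, f ≫ g₁, g₂, by simp⟩

lemma comp_right {f : M₁ ⟶ M₂} (hf : NullHomotopic δ f) (g : M₂ ⟶ M₃) :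
    NullHomotopic δ (f ≫ g) := by
  obtain ⟨N, g₁, g₂, rfl⟩ := hf
  exact ⟨N, g₁, g₂ ≫ g, by simp⟩

end NullHomotopic

/-- Two morphisms of `A`-modules are homotopic if their difference is null-homotopic. -/
def homotopyRel : HomRel (ModuleCat.{v} A) := fun _ _ f g => NullHomotopic δ (f - g)

instance : Congruence (homotopyRel δ) where
  equivalence :=
    { refl := fun f => by
        simpa only [homotopyRel, sub_self] using NullHomotopic.zero
      symm := fun {f g} h => by
        simpa only [homotopyRel, neg_sub] using NullHomotopic.neg h
      trans := fun {f g l} h h' => by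
        simpa only [homotopyRel, sub_add_sub_cancel] using NullHomotopic.add h h' }
  comp_left f _ _ h := by
    simpa only [homotopyRel, Preadditive.comp_sub] using NullHomotopic.comp_left f h
  comp_right g h := by
    simpa only [homotopyRel, Preadditive.sub_comp] using NullHomotopic.comp_right h g

lemma homotopyRel_add ⦃X Y : ModuleCat.{v} A⦄ (f₁ f₂ g₁ g₂ : X ⟶ Y)
    (hf : homotopyRel δ f₁ f₂) (hg : homotopyRel δ g₁ g₂) :
    homotopyRel δ (f₁ + g₁) (f₂ + g₂) := by
  simpa only [homotopyRel, add_sub_add_comm] using NullHomotopic.add hf hg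

/-- The quotient of `A-mod` by the ideal of null-homotopic morphisms. -/
def StableCat : Type _ := CategoryTheory.Quotient (homotopyRel δ)

instance : Category (StableCat δ) :=
  inferInstanceAs (Category (CategoryTheory.Quotient (homotopyRel δ)))

instance : Preadditive (StableCat δ) :=
  CategoryTheory.Quotient.preadditive (homotopyRel δ) (homotopyRel_add δ)

/-- The quotient functor from `A-mod` to its stable category. -/
def toStable : ModuleCat.{v} A ⥤ StableCat δ :=
  CategoryTheory.Quotient.functor (homotopyRel δ)

instance : (toStable δ).Additive :=
  CategoryTheory.Quotient.functor_additive (homotopyRel δ) (homotopyRel_add δ)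

instance : HasZeroObject (StableCat δ) :=
  ⟨(toStable δ).obj (ModuleCat.of A PUnit),
    (toStable δ).map_isZero (ModuleCat.isZero_of_subsingleton _)⟩

variable (Λ : LeftIntegral k H)

/-- The functor `T M = (H / kΛ) ⊗ M` on `A`-modules. -/
def shiftT : ModuleCat.{v} A ⥤ ModuleCat.{v} A := tensorFunctor δ (H ⧸ Λ.line)

variable {δ} in
/-- The inclusion `x = Λ ⊗ Id : X → H ⊗ X`. -/
def unitMap (X : ModuleCat.{v} A) : X ⟶ (tensorFunctor δ H).obj X :=
  ModuleCat.ofHom (integralMap δ Λ)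

variable {δ} in
/-- The quotient map `H ⊗ X → T X = (H / kΛ) ⊗ X`. -/
def quotMap (X : ModuleCat.{v} A) : (tensorFunctor δ H).obj X ⟶ (shiftT δ Λ).obj X :=
  ModuleCat.ofHom (tensorMap δ Λ.line.mkQ LinearMap.id)

lemma unitMap_quotMap (X : ModuleCat.{v} A) :
    unitMap (δ := δ) Λ X ≫ quotMap Λ X = 0 := by
  ext x
  change ((Λ.line.mkQ Λ.elt) ⊗ₜ[k] x : (H ⧸ Λ.line) ⊗[k] X) = 0
  have : Λ.line.mkQ Λ.elt = 0 := by
    rw [Submodule.mkQ_apply, Submodule.Quotient.mk_eq_zero]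
    exact ⟨1, (one_smul k _).symm⟩
  rw [this, TensorProduct.zero_tmul]

variable {X Y : ModuleCat.{v} A} (u : X ⟶ Y)

/-- The cone `C_u` of `u : X ⟶ Y`: the pushout of `u` along `X → H ⊗ X`. -/
def cone : ModuleCat.{v} A := pushout u (unitMap (δ := δ) Λ X)

/-- The morphism `v : Y ⟶ C_u` of the pushout square. -/
def coneIn : Y ⟶ cone δ Λ u := pushout.inl u (unitMap (δ := δ) Λ X)

/-- The morphism `w : C_u ⟶ T X` which vanishes on `Y` and is the quotient map on `H ⊗ X`. -/
def coneOut : cone δ Λ u ⟶ (shiftT δ Λ).obj X :=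
  pushout.desc 0 (quotMap Λ X) (by rw [comp_zero, unitMap_quotMap])

variable [HasShift (StableCat δ) ℤ]

/-- The standard triangle `X ⟶ Y ⟶ C_u ⟶ T X` in the stable category. Here `e` identifies the
shift functor `⟦1⟧` of the stable category with the functor that `T` induces on it. -/
def standardTriangle
    (e : toStable δ ⋙ shiftFunctor (StableCat δ) (1 : ℤ) ≅ shiftT δ Λ ⋙ toStable δ) :
    Triangle (StableCat δ) :=
  Triangle.mk ((toStable δ).map u) ((toStable δ).map (coneIn δ Λ u))
    ((toStable δ).map (coneOut δ Λ u) ≫ e.inv.app X)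

end

end Hopfological

end

open CategoryTheory CategoryTheory.Pretriangulated Hopfological

universe u v u'

/-! The functor `H ⊗ -` on `A`-modules behaves like the injective hulls of a Frobenius category.
The counit `H ⊗ M → M` is an epimorphism, `Λ ⊗ - : M → H ⊗ M` is a monomorphism with cokernel
`T M`, and both split after applying `H ⊗ -` as well as on modules of the form `H ⊗ N`. For the
counit, the splittings are given by the comultiplication. For `Λ ⊗ -`, they come from `H`-linear
maps `H ⊗ H → H` sending `h ⊗ Λ`, respectively `Λ ⊗ h`, to `h`. Any `φ` in the dual of `H` gives an
`H`-linear map `a ⊗ b ↦ φ(S(a₂) b) a₁`. It sends `h ⊗ Λ` to `φ(Λ) h`, so `φ(Λ) = 1` yields the first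
map. It sends `Λ ⊗ h` to `h` times the slice along `φ` of the Casimir element `Λ₁ ⊗ S(Λ₂)`, and
since `H` is a Frobenius algebra this slice is `1` for some `φ`, which yields the second.

Happel's argument for Frobenius categories then applies: every stable morphism is represented by a
monomorphism `i : X → Y` along which `X → H ⊗ X` extends, and the cone of such an `i` is stably its
cokernel, so that the octahedral axiom comes down to the third isomorphism theorem. The shift has
to be an action of `ℤ`, whereas the functor induced by `T` is only an equivalence: it is transported
from the reindexing of spectra `(Xₙ)` with `T Xₙ ≅ Xₙ₊₁`. -/

noncomputable section

namespace Hopfological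

open Category Limits Preadditive

/-! ### The shift attached to a self-equivalence -/

section Spectrum

variable {C : Type*} [Category* C]

/-- A spectrum for an endofunctor `T`: objects `Xₙ` indexed by `n : ℤ`, with isomorphisms
`T Xₙ ≅ Xₙ₊₁`. Reindexing is an action of `ℤ` on spectra, while for an equivalence `T` a spectrum
is determined by `X₀`; this turns the powers of `T` into a coherent shift. The indices `i` and
`j = i + 1` are kept separate in order to avoid casts. -/
structure Spectrum (T : C ⥤ C) where
  X : ℤ → C
  iso : ∀ i j : ℤ, i + 1 = j → (T.obj (X i) ≅ X j)

namespace Spectrum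

variable {T : C ⥤ C}

/-- A morphism of spectra is a family of morphisms compatible with the structure isomorphisms. -/
@[ext]
structure Hom (X Y : Spectrum T) where
  f : ∀ i, X.X i ⟶ Y.X i
  comm : ∀ i j h, (X.iso i j h).hom ≫ f j = T.map (f i) ≫ (Y.iso i j h).hom

instance : Category (Spectrum T) where
  Hom := Hom
  id X := { f := fun i => 𝟙 _, comm := by simp }
  comp φ ψ :=
    { f := fun i => φ.f i ≫ ψ.f i
      comm := fun i j h => by rw [reassoc_of% φ.comm i j h, ψ.comm, T.map_comp, assoc] }
  id_comp f := by apply Hom.ext; simp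
  comp_id f := by apply Hom.ext; simp
  assoc f g h := by apply Hom.ext; simp

variable {X Y Z : Spectrum T}

@[ext]
lemma hom_ext {f g : X ⟶ Y} (h : ∀ i, f.f i = g.f i) : f = g :=
  Hom.ext (funext h)

@[simp]
lemma comp_f (f : X ⟶ Y) (g : Y ⟶ Z) (i : ℤ) : (f ≫ g).f i = f.f i ≫ g.f i := rfl

@[simp]
lemma eqToHom_f (h : X = Y) (i : ℤ) : Hom.f (eqToHom h) i = eqToHom (by rw [h]) := by
  subst h; rfl

lemma iso_hom_comp_eqToHom (X : Spectrum T) {i i' j j' : ℤ} (hi : i = i') (h : i + 1 = j)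
    (h' : i' + 1 = j') :
    (X.iso i j h).hom ≫ eqToHom (congrArg X.X (by lia)) =
      T.map (eqToHom (congrArg X.X hi)) ≫ (X.iso i' j' h').hom := by
  subst hi h h'; simp

lemma f_comp_eqToHom (f : X ⟶ Y) {i j : ℤ} (h : i = j) :
    f.f i ≫ eqToHom (congrArg Y.X h) = eqToHom (congrArg X.X h) ≫ f.f j := by
  subst h; simp

/-- An isomorphism of spectra from its components. -/
def isoMk (e : ∀ i, X.X i ≅ Y.X i)
    (h : ∀ i j h, (X.iso i j h).hom ≫ (e j).hom = T.map (e i).hom ≫ (Y.iso i j h).hom) :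
    X ≅ Y where
  hom := { f := fun i => (e i).hom, comm := h }
  inv :=
    { f := fun i => (e i).inv
      comm := fun i j hij => by
        rw [← cancel_mono (e j).hom, assoc, assoc, Iso.inv_hom_id, comp_id, h i j hij,
          ← T.map_comp_assoc, Iso.inv_hom_id, T.map_id, id_comp] }

/-- The evaluation of spectra in degree `i`. -/
def eval (T : C ⥤ C) (i : ℤ) : Spectrum T ⥤ C where
  obj X := X.X i
  map f := f.f i

/-- Evaluations in consecutive degrees differ by `T`. -/
def evalCompIso (T : C ⥤ C) (i j : ℤ) (h : i + 1 = j) : eval T i ⋙ T ≅ eval T j :=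
  NatIso.ofComponents (fun X => X.iso i j h) (fun f => (f.comm i j h).symm)

/-- The reindexing of spectra by `i ↦ i + a`. -/
@[simps]
def reindex (T : C ⥤ C) (a : ℤ) : Spectrum T ⥤ Spectrum T where
  obj X :=
    { X := fun i => X.X (i + a)
      iso := fun i j h => X.iso (i + a) (j + a) (by lia) }
  map f := { f := fun i => f.f (i + a), comm := fun _ _ _ => f.comm _ _ _ }

/-- Reindexing by `0` is isomorphic to the identity. -/
def reindexZero (T : C ⥤ C) : reindex T 0 ≅ 𝟭 (Spectrum T) :=
  NatIso.ofComponents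
    (fun X => isoMk (fun i => eqToIso (congrArg X.X (add_zero i)))
      (fun i _ _ => X.iso_hom_comp_eqToHom (add_zero i) _ _))
    (fun f => by ext i; exact f_comp_eqToHom f (add_zero i))

/-- Reindexing by `a + b` is isomorphic to reindexing by `a` and then by `b`. -/
def reindexAdd (T : C ⥤ C) (a b : ℤ) : reindex T (a + b) ≅ reindex T a ⋙ reindex T b :=
  NatIso.ofComponents
    (fun X => isoMk (fun i => eqToIso (congrArg X.X (by lia : i + (a + b) = i + b + a)))
      (fun i _ _ => X.iso_hom_comp_eqToHom (by lia : i + (a + b) = i + b + a) _ _))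
    (fun f => by ext i; exact f_comp_eqToHom f (by lia : i + (a + b) = i + b + a))

@[simp]
lemma reindexZero_inv_app_f (X : Spectrum T) (i : ℤ) :
    Hom.f ((reindexZero T).inv.app X) i = eqToHom (congrArg X.X (add_zero i).symm) := rfl

@[simp]
lemma reindexAdd_hom_app_f (a b : ℤ) (X : Spectrum T) (i : ℤ) :
    Hom.f ((reindexAdd T a b).hom.app X) i =
      eqToHom (congrArg X.X (by lia : i + (a + b) = i + b + a)) := rfl

instance : HasShift (Spectrum T) ℤ :=
  hasShiftMk _ _
    { F := reindex T
      zero := reindexZero T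
      add := reindexAdd T
      assoc_hom_app := fun a b c X => by
        ext i
        simp only [comp_f, reindexAdd_hom_app_f, reindex_map_f, eqToHom_f]
        exact (eqToHom_trans _ _).trans
          ((congrArg (_ ≫ ·) (eqToHom_trans _ _)).trans (eqToHom_trans _ _)).symm
      zero_add_hom_app := fun a X => by
        ext i
        simp only [comp_f, reindexAdd_hom_app_f, reindex_map_f, reindexZero_inv_app_f, eqToHom_f]
        exact (eqToHom_trans _ _).symm
      add_zero_hom_app := fun a X => by
        ext i
        simp only [comp_f, reindexAdd_hom_app_f, reindexZero_inv_app_f, eqToHom_f]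
        exact (eqToHom_trans _ _).symm }

instance [T.Faithful] : (eval T 0).Faithful where
  map_injective {X Y f g} h := by
    ext i
    induction i using Int.induction_on with
    | zero => exact h
    | succ i hi =>
      rw [← cancel_epi (X.iso i (i + 1) rfl).hom, f.comm, g.comm, hi]
    | pred i hi =>
      apply T.map_injective
      rw [← cancel_mono (Y.iso (-i - 1) (-i) (by lia)).hom, ← f.comm, ← g.comm, hi]

section Full

variable [T.Full] (f : X.X 0 ⟶ Y.X 0)

/-- The extension to nonnegative degrees of a morphism in degree zero. -/
def extendNat : ∀ n : ℕ, X.X (Int.ofNat n) ⟶ Y.X (Int.ofNat n)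
  | 0 => f
  | n + 1 => (X.iso (Int.ofNat n) (Int.ofNat (n + 1)) (by simp)).inv ≫ T.map (extendNat n) ≫
      (Y.iso (Int.ofNat n) (Int.ofNat (n + 1)) (by simp)).hom

/-- The extension to negative degrees of a morphism in degree zero. -/
def extendNegSucc : ∀ n : ℕ, X.X (Int.negSucc n) ⟶ Y.X (Int.negSucc n)
  | 0 => T.preimage ((X.iso (Int.negSucc 0) 0 (by simp)).hom ≫ f ≫
      (Y.iso (Int.negSucc 0) 0 (by simp)).inv)
  | n + 1 => T.preimage ((X.iso (Int.negSucc (n + 1)) (Int.negSucc n) (by lia)).hom ≫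
      extendNegSucc n ≫ (Y.iso (Int.negSucc (n + 1)) (Int.negSucc n) (by lia)).inv)

/-- The extension to all degrees of a morphism in degree zero. -/
def extend : X ⟶ Y where
  f
    | Int.ofNat n => extendNat f n
    | Int.negSucc n => extendNegSucc f n
  comm i j h := by
    subst h
    match i with
    | Int.ofNat n =>
      change _ ≫ extendNat f (n + 1) = _
      simp [extendNat]
    | Int.negSucc 0 =>
      change _ ≫ f = T.map (extendNegSucc f 0) ≫ _
      simp [extendNegSucc]
    | Int.negSucc (n + 1) =>
      change (X.iso (Int.negSucc (n + 1)) (Int.negSucc n) _).hom ≫ extendNegSucc f n =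
        T.map (extendNegSucc f (n + 1)) ≫ (Y.iso (Int.negSucc (n + 1)) (Int.negSucc n) _).hom
      simp [extendNegSucc]

instance : (eval T 0).Full where
  map_surjective f := ⟨extend f, rfl⟩

end Full

/-- The iterates of `T` on an object. -/
def iterObj (T : C ⥤ C) (X : C) : ℕ → C
  | 0 => X
  | n + 1 => T.obj (iterObj T X n)

/-- The iterated preimages under `T` of an object, starting with the first one. -/
def iterPreimage (T : C ⥤ C) [T.EssSurj] (X : C) : ℕ → C
  | 0 => T.objPreimage X
  | n + 1 => T.objPreimage (iterPreimage T X n)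

/-- A spectrum with a given object in degree zero. -/
def ofObj (T : C ⥤ C) [T.EssSurj] (X : C) : Spectrum T where
  X
    | Int.ofNat n => iterObj T X n
    | Int.negSucc n => iterPreimage T X n
  iso i j h := match i, j, h with
    | Int.ofNat n, _, rfl => Iso.refl (T.obj (iterObj T X n))
    | Int.negSucc 0, _, rfl => T.objObjPreimageIso X
    | Int.negSucc (n + 1), _, rfl => T.objObjPreimageIso (iterPreimage T X n)

instance [T.EssSurj] : (eval T 0).EssSurj where
  mem_essImage X := ⟨ofObj T X, ⟨Iso.refl _⟩⟩

instance [T.IsEquivalence] : (eval T 0).IsEquivalence where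

end Spectrum

end Spectrum

section Shift

variable {C : Type*} [Category* C] (T : C ⥤ C) [T.IsEquivalence]

/-- The `n`-th power of a self-equivalence `T`, for `n : ℤ`: reindexing by `n`, transported along
the equivalence between `T`-spectra and their objects in degree zero. -/
def zpowFunctor (n : ℤ) : C ⥤ C :=
  (Spectrum.eval T 0).inv ⋙ shiftFunctor (Spectrum T) n ⋙ Spectrum.eval T 0

/-- The shift by `ℤ` given by the powers of a self-equivalence. -/
abbrev hasShiftOfIsEquivalence : HasShift C ℤ :=
  (Functor.FullyFaithful.ofFullyFaithful (Spectrum.eval T 0).inv).hasShift (zpowFunctor T)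
    (fun n => Functor.isoWhiskerLeft ((Spectrum.eval T 0).inv ⋙ shiftFunctor (Spectrum T) n)
      (Spectrum.eval T 0).asEquivalence.unitIso.symm)

/-- The shift by `1` given by the powers of `T` is isomorphic to `T`. -/
def shiftFunctorOneIso :
    letI := hasShiftOfIsEquivalence T
    shiftFunctor C (1 : ℤ) ≅ T :=
  Functor.isoWhiskerLeft (Spectrum.eval T 0).inv (Spectrum.evalCompIso T 0 1 rfl).symm ≪≫
    Functor.isoWhiskerRight (Spectrum.eval T 0).asEquivalence.counitIso T ≪≫ T.leftUnitor

end Shift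

lemma additive_shiftFunctor_of_one {C : Type*} [Category* C] [Preadditive C] [HasShift C ℤ]
    (h : (shiftFunctor C (1 : ℤ)).Additive) (n : ℤ) : (shiftFunctor C n).Additive := by
  have : (shiftEquiv C (1 : ℤ)).functor.Additive := h
  have : (shiftFunctor C (-1 : ℤ)).Additive :=
    Equivalence.inverse_additive (shiftEquiv C (1 : ℤ))
  induction n using Int.induction_on with
  | zero => exact Functor.additive_of_iso (shiftFunctorZero C ℤ).symm
  | succ i _ => exact Functor.additive_of_iso (shiftFunctorAdd C (i : ℤ) 1).symm
  | pred i _ => exact Functor.additive_of_iso (shiftFunctorAdd C (-i : ℤ) (-1)).symm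

/-! ### Right triangulations -/

section RightTriangulation

open scoped ZeroObject

/-- An isomorphism of triangles from isomorphisms of their objects. -/
def triangleMkIso {Q : Type*} [Category* Q] [HasShift Q ℤ] {X Y Z X' Y' Z' : Q}
    {f : X ⟶ Y} {g : Y ⟶ Z} {h : Z ⟶ X⟦(1 : ℤ)⟧} {f' : X' ⟶ Y'} {g' : Y' ⟶ Z'}
    {h' : Z' ⟶ X'⟦(1 : ℤ)⟧} (a : X ≅ X') (b : Y ≅ Y') (c : Z ≅ Z')
    (h₁ : f ≫ b.hom = a.hom ≫ f') (h₂ : g ≫ c.hom = b.hom ≫ g')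
    (h₃ : h ≫ a.hom⟦(1 : ℤ)⟧' = c.hom ≫ h') : Triangle.mk f g h ≅ Triangle.mk f' g' h' :=
  Triangle.isoMk _ _ a b c h₁ h₂ h₃

variable {Q : Type*} [Category* Q] [Preadditive Q] [HasZeroObject Q] [HasShift Q ℤ]

/-- The axioms of a pretriangulated category for a class `D` of distinguished triangles, except
that rotations of distinguished triangles are only required to be distinguished in the forward
direction, as for a shift functor that need not be invertible. -/
structure IsRightTriangulation (D : Set (Triangle Q)) : Prop where
  mem_of_iso : ∀ {t t' : Triangle Q}, t ∈ D → (t' ≅ t) → t' ∈ D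
  contractible_mem : ∀ X : Q, contractibleTriangle X ∈ D
  exists_mem : ∀ {X Y : Q} (f : X ⟶ Y),
    ∃ (Z : Q) (g : Y ⟶ Z) (h : Z ⟶ X⟦(1 : ℤ)⟧), Triangle.mk f g h ∈ D
  rotate_mem : ∀ {t : Triangle Q}, t ∈ D → t.rotate ∈ D
  exists_hom : ∀ {t t' : Triangle Q}, t ∈ D → t' ∈ D →
    ∀ (a : t.obj₁ ⟶ t'.obj₁) (b : t.obj₂ ⟶ t'.obj₂), t.mor₁ ≫ b = a ≫ t'.mor₁ →
      ∃ c : t.obj₃ ⟶ t'.obj₃, t.mor₂ ≫ c = b ≫ t'.mor₂ ∧ t.mor₃ ≫ a⟦(1 : ℤ)⟧' = c ≫ t'.mor₃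

namespace IsRightTriangulation

variable {D : Set (Triangle Q)} (hD : IsRightTriangulation D)

include hD

lemma exists_hom_of_rotate_mem {X Y Z Z' : Q} {f : X ⟶ Y} {g : Y ⟶ Z} {h : Z ⟶ X⟦(1 : ℤ)⟧}
    {g' : Y ⟶ Z'} {h' : Z' ⟶ X⟦(1 : ℤ)⟧}
    (ht : (Triangle.mk f g h).rotate ∈ D) (ht' : (Triangle.mk f g' h').rotate ∈ D) :
    ∃ γ : Z ⟶ Z', g ≫ γ = g' ∧ γ ≫ h' = h := by
  obtain ⟨c, hc, hc'⟩ : ∃ c : Z⟦(1 : ℤ)⟧ ⟶ Z'⟦(1 : ℤ)⟧,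
      (-g⟦(1 : ℤ)⟧') ≫ c = 𝟙 _ ≫ (-g'⟦(1 : ℤ)⟧') ∧
      (-h⟦(1 : ℤ)⟧') ≫ (𝟙 (X⟦(1 : ℤ)⟧))⟦(1 : ℤ)⟧' = c ≫ (-h'⟦(1 : ℤ)⟧') :=
    hD.exists_hom (hD.rotate_mem (hD.rotate_mem ht)) (hD.rotate_mem (hD.rotate_mem ht'))
      (𝟙 (X⟦(1 : ℤ)⟧)) (𝟙 (Y⟦(1 : ℤ)⟧)) ((comp_id _).trans (id_comp _).symm)
  obtain ⟨γ, rfl⟩ := (shiftFunctor Q (1 : ℤ)).map_surjective c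
  refine ⟨γ, (shiftFunctor Q (1 : ℤ)).map_injective ?_, (shiftFunctor Q (1 : ℤ)).map_injective ?_⟩
  · simpa using hc
  · simpa using hc'.symm

variable [(shiftFunctor Q (1 : ℤ)).Additive]

lemma contractible_mem₁ (W : Q) : Triangle.mk (0 : (0 : Q) ⟶ W) (𝟙 W) 0 ∈ D := by
  let i : W⟦(-1 : ℤ)⟧⟦(1 : ℤ)⟧ ≅ W := (shiftEquiv Q (1 : ℤ)).counitIso.app W
  have h : Triangle.mk (0 : (0 : Q) ⟶ W⟦(-1 : ℤ)⟧⟦(1 : ℤ)⟧) (-(𝟙 (W⟦(-1 : ℤ)⟧))⟦(1 : ℤ)⟧')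
      (-(0 : W⟦(-1 : ℤ)⟧ ⟶ 0)⟦(1 : ℤ)⟧') ∈ D :=
    hD.rotate_mem (hD.rotate_mem (hD.contractible_mem _))
  exact hD.mem_of_iso h
    (triangleMkIso (Iso.refl _) i.symm (-i.symm) (by simp) (by simp) (by simp))

lemma exists_desc {t : Triangle Q} (ht : t ∈ D) {W : Q} (k : t.obj₂ ⟶ W)
    (hk : t.mor₁ ≫ k = 0) : ∃ l : t.obj₃ ⟶ W, t.mor₂ ≫ l = k := by
  obtain ⟨l, hl, -⟩ := hD.exists_hom ht (hD.contractible_mem₁ W) 0 k (hk.trans zero_comp.symm)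
  exact ⟨l, hl.trans (comp_id k)⟩

lemma isIso_of_comp_eq {t : Triangle Q} (ht : t.rotate ∈ D) (α : t.obj₃ ⟶ t.obj₃)
    (h₂ : t.mor₂ ≫ α = t.mor₂) (h₃ : α ≫ t.mor₃ = t.mor₃) : IsIso α := by
  obtain ⟨a, ha⟩ : ∃ a, t.mor₃ ≫ a = α - 𝟙 _ :=
    hD.exists_desc ht (α - 𝟙 _) (by
      change t.mor₂ ≫ (α - 𝟙 _) = 0
      rw [comp_sub, h₂, comp_id, sub_self])
  have hα : α ≫ (α - 𝟙 _) = α - 𝟙 _ := by rw [← ha, reassoc_of% h₃]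
  have hα' : α ≫ α = α - 𝟙 _ + α := by rw [← hα]; simp
  refine ⟨𝟙 _ + 𝟙 _ - α, ?_, ?_⟩
  · rw [comp_sub, comp_add, comp_id, hα']
    abel
  · rw [sub_comp, add_comp, id_comp, hα']
    abel

lemma mem_of_rotate_mem {t : Triangle Q} (ht : t.rotate ∈ D) : t ∈ D := by
  obtain ⟨X, Y, Z, f, g, h⟩ := t
  change (Triangle.mk f g h).rotate ∈ D at ht
  change Triangle.mk f g h ∈ D
  obtain ⟨Z', g', h', ht'⟩ := hD.exists_mem f
  have ht'' := hD.rotate_mem ht'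
  obtain ⟨γ, hγ₁, hγ₂⟩ := hD.exists_hom_of_rotate_mem ht ht''
  obtain ⟨γ', hγ₁', hγ₂'⟩ := hD.exists_hom_of_rotate_mem ht'' ht
  have : IsIso (γ ≫ γ') := hD.isIso_of_comp_eq ht (γ ≫ γ')
    (show g ≫ γ ≫ γ' = g by rw [reassoc_of% hγ₁, hγ₁'])
    (show (γ ≫ γ') ≫ h = h by rw [assoc, hγ₂', hγ₂])
  have : IsIso (γ' ≫ γ) := hD.isIso_of_comp_eq ht'' (γ' ≫ γ)
    (show g' ≫ γ' ≫ γ = g' by rw [reassoc_of% hγ₁', hγ₁])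
    (show (γ' ≫ γ) ≫ h' = h' by rw [assoc, hγ₂, hγ₂'])
  have : Mono γ := mono_of_mono γ γ'
  have : IsSplitEpi γ := ⟨⟨inv (γ' ≫ γ) ≫ γ', by simp⟩⟩
  have : IsIso γ := isIso_of_mono_of_isSplitEpi γ
  exact hD.mem_of_iso ht' (triangleMkIso (Iso.refl _) (Iso.refl _) (asIso γ) (by simp)
    (by simp [hγ₁]) (by simp [hγ₂]))

end IsRightTriangulation

/-- A right triangulation for an invertible shift is a triangulation (without the octahedral
axiom). -/
abbrev IsRightTriangulation.pretriangulated [∀ n : ℤ, (shiftFunctor Q n).Additive]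
    {D : Set (Triangle Q)} (hD : IsRightTriangulation D) : Pretriangulated Q where
  distinguishedTriangles := D
  isomorphic_distinguished _ ht _ i := hD.mem_of_iso ht i
  contractible_distinguished := hD.contractible_mem
  distinguished_cocone_triangle := hD.exists_mem
  rotate_distinguished_triangle _ := ⟨hD.rotate_mem, hD.mem_of_rotate_mem⟩
  complete_distinguished_triangle_morphism _ _ ht ht' := hD.exists_hom ht ht'

end RightTriangulation

/-! ### Relative Frobenius structures -/

section Abelian

variable {C : Type*} [Category* C] [Abelian C]

lemma isSplitEpi_g_of_isSplitMono_f {S : ShortComplex C} (hS : S.Exact) [Epi S.g]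
    [IsSplitMono S.f] : IsSplitEpi S.g :=
  (ShortComplex.Splitting.ofExactOfRetraction S hS (retraction S.f) (IsSplitMono.id S.f)
    inferInstance).isSplitEpi_g

lemma isSplitMono_f_of_isSplitEpi_g {S : ShortComplex C} (hS : S.Exact) [Mono S.f]
    [IsSplitEpi S.g] : IsSplitMono S.f :=
  (ShortComplex.Splitting.ofExactOfSection S hS (section_ S.g) (IsSplitEpi.id S.g)
    inferInstance).isSplitMono_f

lemma exact_of_isPushout {X Y Z P W : C} {f : X ⟶ Y} {g : X ⟶ Z} {inl : Y ⟶ P} {inr : Z ⟶ P}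
    (sq : IsPushout f g inl inr) {p : Y ⟶ W} {w : f ≫ p = 0}
    (hp : (ShortComplex.mk f p w).Exact) [Epi p] {c : P ⟶ W} (hc : inl ≫ c = p)
    (hc' : inr ≫ c = 0) : (ShortComplex.mk inr c hc').Exact := by
  have : Epi c := epi_of_epi_fac hc
  apply ShortComplex.exact_of_g_is_cokernel
  refine CokernelCofork.IsColimit.ofπ' _ _ (fun {V} k hk => ?_)
  dsimp at k hk
  have h : f ≫ inl ≫ k = 0 := by rw [sq.w_assoc, hk, comp_zero]
  refine ⟨hp.desc (inl ≫ k) h, sq.hom_ext ?_ ?_⟩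
  · simpa [reassoc_of% hc] using hp.g_desc (inl ≫ k) h
  · simp [reassoc_of% hc', hk]

end Abelian

/-- An exact endofunctor `I` of an abelian category, with natural monomorphisms `ι : X ⟶ I X` whose
cokernel is `q : I X ⟶ T X` and natural epimorphisms `ε : I X ⟶ X`, such that `ι` and `ε` become
split after application of `I` and are split on the objects `I X`. With respect to the short exact
sequences that are split by `I`, this is a Frobenius category in which the objects `I X` are
projective and injective. -/
structure RelativeFrobenius (C : Type*) [Category* C] [Abelian C] where
  I : C ⥤ C
  T : C ⥤ C
  ι : ∀ X, X ⟶ I.obj X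
  q : ∀ X, I.obj X ⟶ T.obj X
  ε : ∀ X, I.obj X ⟶ X
  ι_naturality : ∀ {X Y : C} (f : X ⟶ Y), f ≫ ι Y = ι X ≫ I.map f
  q_naturality : ∀ {X Y : C} (f : X ⟶ Y), I.map f ≫ q Y = q X ≫ T.map f
  ε_naturality : ∀ {X Y : C} (f : X ⟶ Y), I.map f ≫ ε Y = ε X ≫ f
  ι_q : ∀ X, ι X ≫ q X = 0
  shortExact : ∀ X, (ShortComplex.mk (ι X) (q X) (ι_q X)).ShortExact
  epi_ε : ∀ X, Epi (ε X)
  additive : I.Additive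
  shortExact_map : ∀ {S : ShortComplex C}, S.ShortExact → (S.map I).ShortExact
  isSplitMono_ι : ∀ X, IsSplitMono (ι (I.obj X))
  isSplitMono_map_ι : ∀ X, IsSplitMono (I.map (ι X))
  isSplitEpi_ε : ∀ X, IsSplitEpi (ε (I.obj X))
  isSplitEpi_map_ε : ∀ X, IsSplitEpi (I.map (ε X))

namespace RelativeFrobenius

attribute [instance] additive epi_ε isSplitMono_ι isSplitMono_map_ι isSplitEpi_ε isSplitEpi_map_ε

attribute [simp] ι_q

variable {C : Type*} [Category* C] [Abelian C] (F : RelativeFrobenius C)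

instance (X : C) : Mono (F.ι X) := (F.shortExact X).mono_f

instance (X : C) : Epi (F.q X) := (F.shortExact X).epi_g

lemma exists_desc_q {X Y : C} (f : F.I.obj X ⟶ Y) (hf : F.ι X ≫ f = 0) :
    ∃ g, F.q X ≫ g = f :=
  ⟨(F.shortExact X).exact.desc f hf, (F.shortExact X).exact.g_desc f hf⟩

lemma exists_lift_ι {X Y : C} (f : Y ⟶ F.I.obj X) (hf : f ≫ F.q X = 0) :
    ∃ g, g ≫ F.ι X = f :=
  ⟨(F.shortExact X).exact.lift f hf, (F.shortExact X).exact.lift_f f hf⟩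

instance : F.T.Additive where
  map_add {X Y f g} := by
    rw [← cancel_epi (F.q X), comp_add, ← F.q_naturality, ← F.q_naturality, ← F.q_naturality,
      F.I.map_add, add_comp]

instance (X : C) : IsSplitEpi (F.I.map (F.q X)) := by
  have h := F.shortExact_map (F.shortExact X)
  have := h.epi_g
  have : IsSplitMono ((ShortComplex.mk (F.ι X) (F.q X) (F.ι_q X)).map F.I).f :=
    F.isSplitMono_map_ι X
  exact isSplitEpi_g_of_isSplitMono_f h.exact

lemma exists_extension_of_isSplitMono {X Y N : C} (i : X ⟶ Y) [IsSplitMono (F.I.map i)]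
    (f : X ⟶ F.I.obj N) : ∃ g, i ≫ g = f := by
  refine ⟨F.ι Y ≫ retraction (F.I.map i) ≫ F.I.map f ≫ retraction (F.ι _), ?_⟩
  rw [reassoc_of% F.ι_naturality i, IsSplitMono.id_assoc, ← reassoc_of% F.ι_naturality f,
    IsSplitMono.id, comp_id]

lemma exists_lift_of_isSplitEpi {N Y Z : C} (p : Y ⟶ Z) [IsSplitEpi (F.I.map p)]
    (f : F.I.obj N ⟶ Z) : ∃ g, g ≫ p = f := by
  refine ⟨section_ (F.ε _) ≫ F.I.map f ≫ section_ (F.I.map p) ≫ F.ε Y, ?_⟩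
  simp only [assoc]
  rw [← F.ε_naturality, IsSplitEpi.id_assoc, F.ε_naturality, IsSplitEpi.id_assoc]

instance (X : C) : IsSplitMono (F.I.map (kernel.ι (F.ε X))) := by
  have h := F.shortExact_map (S := ShortComplex.mk (kernel.ι (F.ε X)) (F.ε X)
    (kernel.condition _)) { exact := ShortComplex.exact_kernel (F.ε X) }
  have := h.mono_f
  have : IsSplitEpi ((ShortComplex.mk (kernel.ι (F.ε X)) (F.ε X)
    (kernel.condition _)).map F.I).g := F.isSplitEpi_map_ε X
  exact isSplitMono_f_of_isSplitEpi_g h.exact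

/-- A morphism is null if it factors through some object `I N`; null morphisms become zero in the
stable category. -/
def Null {X Y : C} (f : X ⟶ Y) : Prop :=
  ∃ (N : C) (a : X ⟶ F.I.obj N) (b : F.I.obj N ⟶ Y), a ≫ b = f

variable {F} in
lemma Null.exists_comp_eq {X Y Z : C} {f : X ⟶ Z} (hf : F.Null f) (i : X ⟶ Y)
    [IsSplitMono (F.I.map i)] : ∃ g, i ≫ g = f := by
  obtain ⟨N, a, b, rfl⟩ := hf
  obtain ⟨g, rfl⟩ := F.exists_extension_of_isSplitMono i a
  exact ⟨g ≫ b, by simp⟩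

variable {F} in
lemma Null.exists_eq_comp {X Y Z : C} {f : X ⟶ Z} (hf : F.Null f) (p : Y ⟶ Z)
    [IsSplitEpi (F.I.map p)] : ∃ g, g ≫ p = f := by
  obtain ⟨N, a, b, rfl⟩ := hf
  obtain ⟨g, rfl⟩ := F.exists_lift_of_isSplitEpi p b
  exact ⟨a ≫ g, by simp⟩

section Ladder

variable {F} {X Y : C} {a : X ⟶ Y} {b : F.I.obj X ⟶ F.I.obj Y} {c : F.T.obj X ⟶ F.T.obj Y}
  (hab : F.ι X ≫ b = a ≫ F.ι Y) (hbc : b ≫ F.q Y = F.q X ≫ c)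

include hab hbc

lemma null_map_T_sub_of_ladder : F.Null (F.T.map a - c) := by
  obtain ⟨d, hd⟩ := F.exists_desc_q (F.I.map a - b) (by
    rw [comp_sub, hab, F.ι_naturality, sub_self])
  refine ⟨Y, d, F.q Y, ?_⟩
  rw [← cancel_epi (F.q X), reassoc_of% hd, sub_comp, hbc, F.q_naturality, comp_sub]

lemma Null.of_ladder (hc : F.Null c) : F.Null a := by
  obtain ⟨d, hd⟩ := hc.exists_eq_comp (F.q Y)
  obtain ⟨h, hh⟩ := F.exists_lift_ι (b - F.q X ≫ d) (by rw [sub_comp, assoc, hd, hbc, sub_self])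
  refine ⟨X, F.ι X, h, ?_⟩
  rw [← cancel_mono (F.ι Y), assoc, hh, comp_sub, hab, reassoc_of% F.ι_q X, zero_comp, sub_zero]

end Ladder

variable {F} in
lemma Null.map_T {X Y : C} {f : X ⟶ Y} (hf : F.Null f) : F.Null (F.T.map f) := by
  obtain ⟨g, rfl⟩ := hf.exists_comp_eq (F.ι X)
  simpa using null_map_T_sub_of_ladder (F := F) (a := F.ι X ≫ g) (b := g ≫ F.ι Y) (c := 0)
    (by simp) (by simp)

variable {F} in
lemma Null.of_map_T {X Y : C} {f : X ⟶ Y} (hf : F.Null (F.T.map f)) : F.Null f :=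
  hf.of_ladder (F.ι_naturality f).symm (F.q_naturality f)

lemma exists_null_map_T_sub {X Y : C} (c : F.T.obj X ⟶ F.T.obj Y) :
    ∃ a : X ⟶ Y, F.Null (F.T.map a - c) := by
  obtain ⟨b, hb⟩ := F.exists_lift_of_isSplitEpi (F.q Y) (F.q X ≫ c)
  obtain ⟨a, ha⟩ := F.exists_lift_ι (F.ι X ≫ b) (by
    rw [assoc, hb, reassoc_of% F.ι_q X, zero_comp])
  exact ⟨a, null_map_T_sub_of_ladder ha.symm hb⟩

section Cone

variable {X Y : C} (u : X ⟶ Y)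

/-- The cone of `u : X ⟶ Y`: the pushout of `u` along `ι : X ⟶ I X`. -/
def cone : C := pushout u (F.ι X)

/-- The morphism from the target of `u` to the cone of `u`. -/
def coneIn : Y ⟶ F.cone u := pushout.inl u (F.ι X)

/-- The morphism from `I X` to the cone of `u : X ⟶ Y`. -/
def coneInr : F.I.obj X ⟶ F.cone u := pushout.inr u (F.ι X)

lemma isPushout_cone : IsPushout u (F.ι X) (F.coneIn u) (F.coneInr u) :=
  IsPushout.of_hasPushout u (F.ι X)

variable {u} in
/-- The morphism from the cone of `u : X ⟶ Y` with given components on `Y` and on `I X`. -/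
def coneDesc {Z : C} (a : Y ⟶ Z) (b : F.I.obj X ⟶ Z) (h : u ≫ a = F.ι X ≫ b) : F.cone u ⟶ Z :=
  pushout.desc a b h

section

variable {u} {Z : C} (a : Y ⟶ Z) (b : F.I.obj X ⟶ Z) (h : u ≫ a = F.ι X ≫ b)

@[simp]
lemma coneIn_coneDesc : F.coneIn u ≫ F.coneDesc a b h = a := pushout.inl_desc _ _ _

@[simp]
lemma coneIn_coneDesc_assoc {W : C} (f : Z ⟶ W) :
    F.coneIn u ≫ F.coneDesc a b h ≫ f = a ≫ f := by
  rw [← assoc, coneIn_coneDesc]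

@[simp]
lemma coneInr_coneDesc : F.coneInr u ≫ F.coneDesc a b h = b := pushout.inr_desc _ _ _

@[simp]
lemma coneInr_coneDesc_assoc {W : C} (f : Z ⟶ W) :
    F.coneInr u ≫ F.coneDesc a b h ≫ f = b ≫ f := by
  rw [← assoc, coneInr_coneDesc]

end

/-- The morphism from the cone of `u : X ⟶ Y` to `T X` which vanishes on `Y` and is `q` on
`I X`. -/
def coneOut : F.cone u ⟶ F.T.obj X := F.coneDesc 0 (F.q X) (by simp)

@[simp]
lemma coneIn_coneOut : F.coneIn u ≫ F.coneOut u = 0 := F.coneIn_coneDesc _ _ _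

@[simp]
lemma coneIn_coneOut_assoc {W : C} (f : F.T.obj X ⟶ W) :
    F.coneIn u ≫ F.coneOut u ≫ f = 0 := by
  rw [← assoc, coneIn_coneOut, zero_comp]

@[simp]
lemma coneInr_coneOut : F.coneInr u ≫ F.coneOut u = F.q X := F.coneInr_coneDesc _ _ _

@[simp]
lemma coneInr_coneOut_assoc {W : C} (f : F.T.obj X ⟶ W) :
    F.coneInr u ≫ F.coneOut u ≫ f = F.q X ≫ f := by
  rw [← assoc, coneInr_coneOut]

lemma exact_coneIn_coneOut :
    (ShortComplex.mk (F.coneIn u) (F.coneOut u) (F.coneIn_coneOut u)).Exact :=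
  exact_of_isPushout (F.isPushout_cone u).flip (F.shortExact X).exact
    (F.coneInr_coneOut u) (F.coneIn_coneOut u)

instance : Epi (F.coneOut u) := epi_of_epi_fac (F.coneInr_coneOut u)

end Cone

section Quotient

variable {Q : Type*} [Category* Q] [Preadditive Q]

/-- A functor to a preadditive category which identifies it with the quotient by the ideal of
null morphisms. -/
structure IsStableQuotient (π : C ⥤ Q) : Prop where
  additive : π.Additive
  full : π.Full
  essSurj : π.EssSurj
  map_eq_zero_iff : ∀ {X Y : C} (f : X ⟶ Y), π.map f = 0 ↔ F.Null f

namespace IsStableQuotient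

variable {F} {π : C ⥤ Q} (hπ : F.IsStableQuotient π)

include hπ

lemma map_eq_map_iff {X Y : C} {f g : X ⟶ Y} : π.map f = π.map g ↔ F.Null (f - g) := by
  have := hπ.additive
  rw [← hπ.map_eq_zero_iff, π.map_sub, sub_eq_zero]

lemma isZero_obj_I (X : C) : IsZero (π.obj (F.I.obj X)) := by
  rw [IsZero.iff_id_eq_zero, ← π.map_id, hπ.map_eq_zero_iff]
  exact ⟨X, 𝟙 _, 𝟙 _, by simp⟩

lemma isIso_map_of_isSplitMono {N Y Z : C} {i : F.I.obj N ⟶ Y} {p : Y ⟶ Z} {w : i ≫ p = 0}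
    (hS : (ShortComplex.mk i p w).Exact) [Epi p] (r : Y ⟶ F.I.obj N) (hr : i ≫ r = 𝟙 _) :
    IsIso (π.map p) := by
  let σ := ShortComplex.Splitting.ofExactOfRetraction _ hS r hr ‹_›
  refine ⟨π.map σ.s, ?_, ?_⟩
  · rw [← π.map_comp, ← π.map_id, eq_comm, hπ.map_eq_map_iff]
    exact ⟨N, r, i, eq_sub_of_add_eq σ.id⟩
  · rw [← π.map_comp, ← π.map_id]
    exact congrArg π.map σ.s_g

lemma exists_replacement {Y Z : C} (v : Y ⟶ Z) :
    ∃ (Z' : C) (j : Y ⟶ Z') (g : Z' ⟶ F.I.obj Y) (p : Z' ⟶ Z),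
      j ≫ g = F.ι Y ∧ j ≫ p = v ∧ IsIso (π.map p) :=
  ⟨F.I.obj Y ⊞ Z, biprod.lift (F.ι Y) v, biprod.fst, biprod.snd, by simp, by simp,
    hπ.isIso_map_of_isSplitMono
      (ShortComplex.Splitting.ofHasBinaryBiproduct (F.I.obj Y) Z).exact biprod.fst (by simp)⟩

lemma isIso_map_coneDesc {X Y Z : C} {i : X ⟶ Y} {p : Y ⟶ Z} {w : i ≫ p = 0}
    (hS : (ShortComplex.mk i p w).Exact) [Epi p] (g : Y ⟶ F.I.obj X) (hg : i ≫ g = F.ι X) :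
    IsIso (π.map (F.coneDesc p 0 (by rw [w, comp_zero]))) := by
  have h₀ : i ≫ p = F.ι X ≫ 0 := by rw [w, comp_zero]
  have h := exact_of_isPushout (F.isPushout_cone i) hS (F.coneIn_coneDesc p 0 h₀)
    (F.coneInr_coneDesc _ _ _)
  have : Epi (F.coneDesc p 0 h₀) := epi_of_epi_fac (F.coneIn_coneDesc p 0 h₀)
  exact hπ.isIso_map_of_isSplitMono h (F.coneDesc g (𝟙 _) (by rw [hg, comp_id]))
    (F.coneInr_coneDesc _ _ _)

/-- For the inclusion `k` of the kernel of `ε : I W ⟶ W`, the cone of `k` is stably isomorphic to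
its cokernel `W`, and also to `T (kernel ε)` since it is an extension of the latter by `I W`. -/
lemma exists_iso_obj_T (W : C) : ∃ K : C, Nonempty (π.obj (F.T.obj K) ≅ π.obj W) := by
  let k := kernel.ι (F.ε W)
  obtain ⟨g, hg⟩ := F.exists_extension_of_isSplitMono k (F.ι (kernel (F.ε W)))
  obtain ⟨b, hb⟩ := F.exists_extension_of_isSplitMono (F.ι (kernel (F.ε W))) k
  have := hπ.isIso_map_coneDesc (ShortComplex.exact_kernel (F.ε W)) g hg
  have := hπ.isIso_map_of_isSplitMono (F.exact_coneIn_coneOut k)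
    (F.coneDesc (𝟙 _) b (by rw [hb, comp_id])) (F.coneIn_coneDesc _ _ _)
  exact ⟨kernel (F.ε W), ⟨(asIso (π.map (F.coneOut k))).symm ≪≫
    asIso (π.map (F.coneDesc (F.ε W) 0 _))⟩⟩

lemma isEquivalence {T' : Q ⥤ Q} (θ : π ⋙ T' ≅ F.T ⋙ π) : T'.IsEquivalence := by
  have := hπ.additive
  have := hπ.full
  have := hπ.essSurj
  have key {X Y : C} (f : X ⟶ Y) :
      T'.map (π.map f) = θ.hom.app X ≫ π.map (F.T.map f) ≫ θ.inv.app Y := by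
    simpa using θ.hom.naturality_assoc f (θ.inv.app Y)
  have hfull : T'.Full := Functor.full_of_comp_essSurj T' π fun X Y φ => by
    obtain ⟨c, hc⟩ := π.map_surjective (θ.inv.app X ≫ φ ≫ θ.hom.app Y)
    obtain ⟨a, ha⟩ := F.exists_null_map_T_sub c
    exact ⟨π.map a, by rw [key, hπ.map_eq_map_iff.2 ha, hc]; simp⟩
  have hfaithful : T'.Faithful := Functor.faithful_of_comp_essSurj T' π fun X Y f g h => by
    obtain ⟨f, rfl⟩ := π.map_surjective f
    obtain ⟨g, rfl⟩ := π.map_surjective g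
    rw [key, key, cancel_epi, cancel_mono, hπ.map_eq_map_iff, ← F.T.map_sub] at h
    exact hπ.map_eq_map_iff.2 h.of_map_T
  have hessSurj : T'.EssSurj := ⟨fun W => by
    obtain ⟨K, ⟨i⟩⟩ := hπ.exists_iso_obj_T (π.objPreimage W)
    exact ⟨π.obj K, ⟨θ.app K ≪≫ i ≪≫ π.objObjPreimageIso W⟩⟩⟩
  exact { faithful := hfaithful, full := hfull, essSurj := hessSurj }

end IsStableQuotient

end Quotient

section Triangles

variable {C : Type*} [Category* C] [Abelian C] {F : RelativeFrobenius C}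
  {Q : Type*} [Category* Q] {π : C ⥤ Q} [HasShift Q ℤ]
  (e : π ⋙ shiftFunctor Q (1 : ℤ) ≅ F.T ⋙ π)

/-- The shift of the image of `X` is the image of `T X`. -/
def shiftIso (X : C) : (π.obj X)⟦(1 : ℤ)⟧ ≅ π.obj (F.T.obj X) := e.app X

lemma shiftIso_hom_naturality {X Y : C} (f : X ⟶ Y) :
    (π.map f)⟦(1 : ℤ)⟧' ≫ (shiftIso e Y).hom = (shiftIso e X).hom ≫ π.map (F.T.map f) :=
  e.hom.naturality f

lemma shiftIso_inv_naturality {X Y : C} (f : X ⟶ Y) :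
    π.map (F.T.map f) ≫ (shiftIso e Y).inv = (shiftIso e X).inv ≫ (π.map f)⟦(1 : ℤ)⟧' :=
  e.inv.naturality f

/-- The image in the stable category of the triangle `X ⟶ Y ⟶ C_u ⟶ T X`. -/
def stdTriangle {X Y : C} (u : X ⟶ Y) : Triangle Q :=
  Triangle.mk (π.map u) (π.map (F.coneIn u)) (π.map (F.coneOut u) ≫ (shiftIso e X).inv)

/-- The triangles isomorphic to the image of some `X ⟶ Y ⟶ C_u ⟶ T X`. -/
def stdTriangles : Set (Triangle Q) :=
  {t | ∃ (X Y : C) (u : X ⟶ Y), Nonempty (t ≅ stdTriangle e u)}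

variable {e}

lemma mem_stdTriangles_of_iso {t t' : Triangle Q} (h : t ∈ stdTriangles e) (i : t' ≅ t) :
    t' ∈ stdTriangles e := by
  obtain ⟨X, Y, u, ⟨j⟩⟩ := h
  exact ⟨X, Y, u, ⟨i ≪≫ j⟩⟩

namespace IsStableQuotient

variable [Preadditive Q] (hπ : F.IsStableQuotient π)

include hπ

lemma mem_stdTriangles_of_exact {X Y Z : C} {i : X ⟶ Y} {p : Y ⟶ Z} {w : i ≫ p = 0}
    (hS : (ShortComplex.mk i p w).Exact) [Epi p] {g : Y ⟶ F.I.obj X} (hg : i ≫ g = F.ι X)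
    {h : Z ⟶ F.T.obj X} (hh : p ≫ h = g ≫ F.q X) :
    Triangle.mk (π.map i) (π.map p) (-(π.map h ≫ (shiftIso e X).inv)) ∈ stdTriangles e := by
  have := hπ.additive
  let c : F.cone i ⟶ Z := F.coneDesc p 0 (by rw [w, comp_zero])
  have : IsIso (π.map c) := hπ.isIso_map_coneDesc hS g hg
  have h₃ : π.map (F.coneOut i) = -π.map (c ≫ h) := by
    rw [← π.map_neg, hπ.map_eq_map_iff, sub_neg_eq_add]
    refine ⟨X, F.coneDesc g (𝟙 _) (by rw [hg, comp_id]), F.q X,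
      (F.isPushout_cone i).hom_ext ?_ ?_⟩
    · simp [c, hh]
    · simp [c]
  refine ⟨X, Y, i, ⟨(triangleMkIso (Iso.refl _) (Iso.refl _) (asIso (π.map c)) ?_ ?_ ?_).symm⟩⟩
  · simp
  · simp [c, ← π.map_comp]
  · simp [h₃]

lemma rotate_stdTriangle_mem [(shiftFunctor Q (1 : ℤ)).Additive] {X Y : C} (u : X ⟶ Y) :
    (stdTriangle e u).rotate ∈ stdTriangles e := by
  change Triangle.mk (π.map (F.coneIn u)) (π.map (F.coneOut u) ≫ (shiftIso e X).inv)
    (-(π.map u)⟦(1 : ℤ)⟧') ∈ stdTriangles e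
  let g : F.cone u ⟶ F.I.obj Y := F.coneDesc (F.ι Y) (F.I.map u) (F.ι_naturality u)
  have h : F.coneOut u ≫ F.T.map u = g ≫ F.q Y := by
    refine (F.isPushout_cone u).hom_ext ?_ ?_
    · simp [g]
    · simp [g, F.q_naturality]
  refine mem_stdTriangles_of_iso (hπ.mem_stdTriangles_of_exact (F.exact_coneIn_coneOut u)
    (F.coneIn_coneDesc _ _ _) h) (triangleMkIso (Iso.refl _) (Iso.refl _) (shiftIso e X) ?_ ?_ ?_)
  · simp
  · simp
  · rw [comp_neg, ← reassoc_of% shiftIso_hom_naturality e u]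
    simp

lemma contractibleTriangle_mem [HasZeroObject Q] (X : Q) :
    contractibleTriangle X ∈ stdTriangles e := by
  have := hπ.essSurj
  let X' := π.objPreimage X
  let i := π.objObjPreimageIso X
  have : IsIso (F.coneInr (𝟙 X')) := (F.isPushout_cone (𝟙 X')).isIso_inr_of_isIso
  have hz : IsZero (π.obj (F.cone (𝟙 X'))) :=
    (hπ.isZero_obj_I X').of_iso (π.mapIso (asIso (F.coneInr (𝟙 X')))).symm
  refine ⟨X', X', 𝟙 X', ⟨triangleMkIso i.symm i.symm ((isZero_zero _).iso hz) ?_ ?_ ?_⟩⟩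
  · rw [π.map_id, id_comp]
    exact (comp_id _).symm
  · exact hz.eq_of_tgt _ _
  · exact (isZero_zero Q).eq_of_src _ _

lemma exists_mem_stdTriangles {X Y : Q} (f : X ⟶ Y) :
    ∃ (Z : Q) (g : Y ⟶ Z) (h : Z ⟶ X⟦(1 : ℤ)⟧), Triangle.mk f g h ∈ stdTriangles e := by
  have := hπ.essSurj
  have := hπ.full
  let i := π.objObjPreimageIso X
  let j := π.objObjPreimageIso Y
  obtain ⟨u, hu⟩ := π.map_surjective (i.hom ≫ f ≫ j.inv)
  refine ⟨_, j.inv ≫ π.map (F.coneIn u),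
    π.map (F.coneOut u) ≫ (shiftIso e _).inv ≫ i.hom⟦1⟧',
    _, _, u, ⟨triangleMkIso i.symm j.symm (Iso.refl _) ?_ ?_ ?_⟩⟩
  · simp [hu]
  · simp
  · simp [← Functor.map_comp]

/- The square `u, u'` commutes up to a null morphism, which factors through `I X` and so can be
absorbed in the `I X`-component of the morphism of cones. -/
lemma exists_hom_stdTriangle {X Y X' Y' : C} (u : X ⟶ Y) (u' : X' ⟶ Y')
    (a : π.obj X ⟶ π.obj X') (b : π.obj Y ⟶ π.obj Y') (h : π.map u ≫ b = a ≫ π.map u') :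
    ∃ c : π.obj (F.cone u) ⟶ π.obj (F.cone u'),
      π.map (F.coneIn u) ≫ c = b ≫ π.map (F.coneIn u') ∧
      (π.map (F.coneOut u) ≫ (shiftIso e X).inv) ≫ a⟦1⟧' =
        c ≫ π.map (F.coneOut u') ≫ (shiftIso e X').inv := by
  have := hπ.full
  obtain ⟨a, rfl⟩ := π.map_surjective a
  obtain ⟨b, rfl⟩ := π.map_surjective b
  rw [← π.map_comp, ← π.map_comp] at h
  obtain ⟨d, hd⟩ := (hπ.map_eq_map_iff.1 h).exists_comp_eq (F.ι X)
  let c : F.cone u ⟶ F.cone u' := F.coneDesc (b ≫ F.coneIn u')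
    (F.I.map a ≫ F.coneInr u' + d ≫ F.coneIn u') (by
      rw [comp_add, reassoc_of% hd, ← reassoc_of% F.ι_naturality a, ← (F.isPushout_cone u').w,
        sub_comp]
      simp)
  have hc : F.coneOut u ≫ F.T.map a = c ≫ F.coneOut u' := by
    refine (F.isPushout_cone u).hom_ext ?_ ?_
    · simp [c]
    · simp [c, F.q_naturality]
  refine ⟨π.map c, ?_, ?_⟩
  · rw [← π.map_comp, ← π.map_comp, F.coneIn_coneDesc]
  · rw [assoc, ← shiftIso_inv_naturality, ← π.map_comp_assoc, ← π.map_comp_assoc, hc]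

lemma exists_hom {t t' : Triangle Q} (ht : t ∈ stdTriangles e) (ht' : t' ∈ stdTriangles e)
    (a : t.obj₁ ⟶ t'.obj₁) (b : t.obj₂ ⟶ t'.obj₂) (h : t.mor₁ ≫ b = a ≫ t'.mor₁) :
    ∃ c : t.obj₃ ⟶ t'.obj₃, t.mor₂ ≫ c = b ≫ t'.mor₂ ∧ t.mor₃ ≫ a⟦1⟧' = c ≫ t'.mor₃ := by
  obtain ⟨X, Y, u, ⟨i⟩⟩ := ht
  obtain ⟨X', Y', u', ⟨i'⟩⟩ := ht'
  obtain ⟨c, hc, hc'⟩ :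
      ∃ c : (stdTriangle e u).obj₃ ⟶ (stdTriangle e u').obj₃,
        (stdTriangle e u).mor₂ ≫ c =
          (i.inv.hom₂ ≫ b ≫ i'.hom.hom₂) ≫ (stdTriangle e u').mor₂ ∧
        (stdTriangle e u).mor₃ ≫ (i.inv.hom₁ ≫ a ≫ i'.hom.hom₁)⟦1⟧' =
          c ≫ (stdTriangle e u').mor₃ :=
    hπ.exists_hom_stdTriangle u u' _ _ (by
      change (stdTriangle e u).mor₁ ≫ _ = _ ≫ (stdTriangle e u').mor₁
      rw [i.inv.comm₁_assoc, reassoc_of% h, i'.hom.comm₁, assoc, assoc])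
  refine ⟨i.hom.hom₃ ≫ c ≫ i'.inv.hom₃, ?_, ?_⟩
  · rw [i.hom.comm₂_assoc, reassoc_of% hc]
    simp
  · simp only [assoc]
    rw [← i'.inv.comm₃, ← reassoc_of% hc', ← i.hom.comm₃_assoc, ← Functor.map_comp,
      ← Functor.map_comp]
    simp

lemma rotate_mem [(shiftFunctor Q (1 : ℤ)).Additive] {t : Triangle Q}
    (ht : t ∈ stdTriangles e) : t.rotate ∈ stdTriangles e := by
  obtain ⟨X, Y, u, ⟨i⟩⟩ := ht
  exact mem_stdTriangles_of_iso (hπ.rotate_stdTriangle_mem u) ((rotate Q).mapIso i)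

variable (e) in
lemma isRightTriangulation [HasZeroObject Q] [(shiftFunctor Q (1 : ℤ)).Additive] :
    IsRightTriangulation (stdTriangles e) where
  mem_of_iso := mem_stdTriangles_of_iso
  contractible_mem := hπ.contractibleTriangle_mem
  exists_mem := hπ.exists_mem_stdTriangles
  rotate_mem := hπ.rotate_mem
  exists_hom := hπ.exists_hom

end IsStableQuotient

section Octahedron

variable {X Y Z : C} {i : X ⟶ Y} {j : Y ⟶ Z}

/-- The connecting morphism `coker i ⟶ T X` determined by an extension `g` of `ι : X ⟶ I X` along
`i`. -/
def connecting (g : Y ⟶ F.I.obj X) (hg : i ≫ g = F.ι X) : cokernel i ⟶ F.T.obj X :=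
  cokernel.desc i (g ≫ F.q X) (by rw [reassoc_of% hg, F.ι_q])

@[simp]
lemma π_connecting (g : Y ⟶ F.I.obj X) (hg : i ≫ g = F.ι X) :
    cokernel.π i ≫ connecting g hg = g ≫ F.q X :=
  cokernel.π_desc _ _ _

lemma cokernelMap_connecting (g : Z ⟶ F.I.obj X) (hg : (i ≫ j) ≫ g = F.ι X) :
    cokernel.map i (i ≫ j) (𝟙 _) j (by simp) ≫ connecting g hg =
      connecting (j ≫ g) (by rw [← hg, assoc]) := by
  ext
  simp

lemma null_connecting_comp_sub (g : Z ⟶ F.I.obj X) (hg : (i ≫ j) ≫ g = F.ι X)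
    (g' : Z ⟶ F.I.obj Y) (hg' : j ≫ g' = F.ι Y) :
    F.Null (connecting g hg ≫ F.T.map i -
      cokernel.map (i ≫ j) j i (𝟙 _) (by simp) ≫ connecting g' hg') := by
  refine ⟨Y, cokernel.desc (i ≫ j) (g ≫ F.I.map i - g') ?_, F.q Y, ?_⟩
  · rw [comp_sub, ← assoc, hg, assoc, hg', F.ι_naturality, sub_self]
  · ext
    simp [F.q_naturality, reassoc_of% π_connecting g hg]

lemma exact_cokernelMap (i : X ⟶ Y) (j : Y ⟶ Z) :
    (ShortComplex.mk (cokernel.map i (i ≫ j) (𝟙 _) j (by simp))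
      (cokernel.map (i ≫ j) j i (𝟙 _) (by simp)) (by ext; simp)).Exact :=
  (kernelCokernelCompSequence_exact i j).exact 3

instance (i : X ⟶ Y) (j : Y ⟶ Z) : Epi (cokernel.map (i ≫ j) j i (𝟙 _) (by simp)) :=
  epi_of_epi_fac (cokernel.π_desc _ _ _)

namespace IsStableQuotient

variable [Preadditive Q] (hπ : F.IsStableQuotient π)

include hπ

lemma cokernelTriangle_mem (g : Y ⟶ F.I.obj X) (hg : i ≫ g = F.ι X) :
    Triangle.mk (π.map i) (π.map (cokernel.π i))
      (-(π.map (connecting g hg) ≫ (shiftIso e X).inv)) ∈ stdTriangles e :=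
  hπ.mem_stdTriangles_of_exact (ShortComplex.exact_cokernel i) hg (π_connecting g hg)

lemma cokernelMapTriangle_mem (i : X ⟶ Y) (g : Z ⟶ F.I.obj Y) (hg : j ≫ g = F.ι Y) :
    Triangle.mk (π.map (cokernel.map i (i ≫ j) (𝟙 _) j (by simp)))
      (π.map (cokernel.map (i ≫ j) j i (𝟙 _) (by simp)))
      ((-(π.map (connecting g hg) ≫ (shiftIso e Y).inv)) ≫ (π.map (cokernel.π i))⟦(1 : ℤ)⟧') ∈
        stdTriangles e := by
  rw [neg_comp, assoc (π.map _), ← shiftIso_inv_naturality, ← π.map_comp_assoc]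
  refine hπ.mem_stdTriangles_of_exact (exact_cokernelMap i j)
    (g := cokernel.desc (i ≫ j) (g ≫ F.I.map (cokernel.π i)) ?_) ?_ ?_
  · rw [assoc, reassoc_of% hg, ← F.ι_naturality, cokernel.condition_assoc, zero_comp]
  · ext
    simp [reassoc_of% hg, F.ι_naturality]
  · ext
    simp [F.q_naturality, reassoc_of% π_connecting g hg]

variable [HasZeroObject Q] [∀ n : ℤ, (shiftFunctor Q n).Additive]

/- The cones of `i`, `i ≫ j` and `j` can be replaced by their cokernels. -/
lemma exists_octahedron (hi : ∃ g, i ≫ g = F.ι X) (hj : ∃ g, j ≫ g = F.ι Y) :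
    letI := (hπ.isRightTriangulation e).pretriangulated
    ∃ (Z₁₂ Z₂₃ Z₁₃ : Q)
      (v₁₂ : π.obj Y ⟶ Z₁₂) (w₁₂ : Z₁₂ ⟶ (π.obj X)⟦(1 : ℤ)⟧)
      (h₁₂ : Triangle.mk (π.map i) v₁₂ w₁₂ ∈ distTriang Q)
      (v₂₃ : π.obj Z ⟶ Z₂₃) (w₂₃ : Z₂₃ ⟶ (π.obj Y)⟦(1 : ℤ)⟧)
      (h₂₃ : Triangle.mk (π.map j) v₂₃ w₂₃ ∈ distTriang Q)
      (v₁₃ : π.obj Z ⟶ Z₁₃) (w₁₃ : Z₁₃ ⟶ (π.obj X)⟦(1 : ℤ)⟧)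
      (h₁₃ : Triangle.mk (π.map i ≫ π.map j) v₁₃ w₁₃ ∈ distTriang Q),
      Nonempty (Triangulated.Octahedron rfl h₁₂ h₂₃ h₁₃) := by
  let := (hπ.isRightTriangulation e).pretriangulated
  obtain ⟨g₀, hg₀⟩ := hi
  obtain ⟨g', hg'⟩ := hj
  obtain ⟨g₁, rfl⟩ := F.exists_extension_of_isSplitMono (F.ι Y) g₀
  have hg : (i ≫ j) ≫ g' ≫ g₁ = F.ι X := by rw [assoc, reassoc_of% hg', hg₀]
  have hgg : connecting (i := i) (j ≫ g' ≫ g₁) (by rw [← hg, assoc]) =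
      connecting (F.ι Y ≫ g₁) hg₀ := by
    congr 1
    rw [reassoc_of% hg']
  have d₁₃ := hπ.cokernelTriangle_mem (e := e) (g' ≫ g₁) hg
  rw [π.map_comp] at d₁₃
  refine ⟨_, _, _, _, _, hπ.cokernelTriangle_mem (F.ι Y ≫ g₁) hg₀, _, _,
    hπ.cokernelTriangle_mem g' hg', _, _, d₁₃,
    ⟨⟨π.map (cokernel.map i (i ≫ j) (𝟙 _) j (by simp)),
      π.map (cokernel.map (i ≫ j) j i (𝟙 _) (by simp)), ?_, ?_, ?_, ?_,
      hπ.cokernelMapTriangle_mem i g' hg'⟩⟩⟩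
  · rw [← π.map_comp, ← π.map_comp, cokernel.π_desc]
  · rw [comp_neg, ← π.map_comp_assoc, cokernelMap_connecting, hgg]
  · rw [← π.map_comp, cokernel.π_desc, id_comp]
  · rw [neg_comp, comp_neg, assoc, ← shiftIso_inv_naturality, ← π.map_comp_assoc,
      ← π.map_comp_assoc, hπ.map_eq_map_iff.2 (null_connecting_comp_sub _ hg g' hg')]

lemma isTriangulated :
    letI := (hπ.isRightTriangulation e).pretriangulated
    IsTriangulated Q := by
  let := (hπ.isRightTriangulation e).pretriangulated
  have := hπ.full
  have := hπ.essSurj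
  refine IsTriangulated.mk' fun X₁ X₂ X₃ u₁₂ u₂₃ => ?_
  let e₁ := π.objObjPreimageIso X₁
  let e₂ := π.objObjPreimageIso X₂
  let e₃ := π.objObjPreimageIso X₃
  obtain ⟨u, hu⟩ := π.map_surjective (e₁.hom ≫ u₁₂ ≫ e₂.inv)
  obtain ⟨Y, i, g, s, hg, rfl, hs⟩ := hπ.exists_replacement u
  obtain ⟨v, hv⟩ := π.map_surjective (π.map s ≫ e₂.hom ≫ u₂₃ ≫ e₃.inv)
  obtain ⟨Z, j, g', s', hg', rfl, hs'⟩ := hπ.exists_replacement v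
  obtain ⟨Z₁₂, Z₂₃, Z₁₃, h⟩ := hπ.exists_octahedron (e := e) ⟨g, hg⟩ ⟨g', hg'⟩
  refine ⟨_, _, _, Z₁₂, Z₂₃, Z₁₃, π.map i, π.map j, e₁.symm, e₂.symm ≪≫ (asIso (π.map s)).symm,
    e₃.symm ≪≫ (asIso (π.map s')).symm, ?_, ?_, h⟩
  · rw [← cancel_mono (π.map s)]
    simpa using (e₁.inv ≫= hu).symm
  · rw [← cancel_mono (π.map s')]
    simpa using (e₂.inv ≫= (inv (π.map s) ≫= hv)).symm

end IsStableQuotient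

end Octahedron

end Triangles

end RelativeFrobenius

/-! ### Integrals and Casimir elements -/

section Convolution

open TensorProduct Coalgebra LinearMap WithConv

variable {R C B : Type*} [CommSemiring R] [AddCommMonoid C] [Module R C] [Coalgebra R C]
  [Semiring B] [Algebra R B]

/-- The endomorphism `c ⊗ b ↦ c₁ ⊗ f(c₂) b` of `C ⊗ B` attached to `f : C → B`. It turns the
convolution product into composition. -/
def convolutionAction (f : C →ₗ[R] B) : C ⊗[R] B →ₗ[R] C ⊗[R] B :=
  (mul' R B ∘ₗ f.rTensor B).lTensor C ∘ₗ (TensorProduct.assoc R C C B).toLinearMap ∘ₗ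
    comul.rTensor B

lemma convolutionAction_tmul {ι : Type*} (f : C →ₗ[R] B) {c : C} (r : Repr R c ι) (b : B) :
    convolutionAction f (c ⊗ₜ b) = ∑ i ∈ r.index, r.left i ⊗ₜ (f (r.right i) * b) := by
  simp [convolutionAction, ← r.eq, sum_tmul]

lemma convolutionAction_comp (f g : WithConv (C →ₗ[R] B)) :
    convolutionAction f.ofConv ∘ₗ convolutionAction g.ofConv =
      convolutionAction (f * g).ofConv := by
  ext c b
  have coassoc := congrArg ((mul' R B ∘ₗ
      TensorProduct.map f.ofConv (mulRight R b ∘ₗ g.ofConv)).lTensor C)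
    (sum_tmul_tmul_eq (ℛ R c) (fun i => ℛ R ((ℛ R c).left i)) (fun i => ℛ R ((ℛ R c).right i)))
  simp only [map_sum, lTensor_tmul, LinearMap.comp_apply, TensorProduct.map_tmul, mul'_apply,
    mulRight_apply] at coassoc
  simp only [TensorProduct.AlgebraTensorModule.curry_apply, TensorProduct.curry_apply,
    LinearMap.coe_restrictScalars, LinearMap.comp_apply, convolutionAction_tmul _ (ℛ R _), map_sum,
    (ℛ R _).convMul_apply, coassoc, Finset.sum_mul, tmul_sum, mul_assoc]

lemma convolutionAction_one :
    convolutionAction (1 : WithConv (C →ₗ[R] B)).ofConv = LinearMap.id := by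
  ext c b
  have counit := congrArg ((toSpanSingleton R B b).lTensor C) (sum_tmul_counit_eq (ℛ R c))
  simp only [map_sum, lTensor_tmul, toSpanSingleton_apply, Algebra.smul_def] at counit
  simpa [convolutionAction_tmul _ (ℛ R c)] using counit

end Convolution

section Contraction

open TensorProduct Coalgebra HopfAlgebra LinearMap WithConv

variable {R H : Type*} [CommSemiring R] [Semiring H] [HopfAlgebra R H]

variable (R H) in
/-- The Galois map `a ⊗ b ↦ a₁ ⊗ a₂ b` of a Hopf algebra, with inverse `a ⊗ b ↦ a₁ ⊗ S(a₂) b`. -/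
def galoisEquiv : H ⊗[R] H ≃ₗ[R] H ⊗[R] H :=
  LinearEquiv.ofLinearMap (convolutionAction .id) (convolutionAction (antipode R))
    (by simpa [convolutionAction_one] using
      convolutionAction_comp (toConv .id) (toConv (antipode R (A := H))))
    (by simpa [convolutionAction_one] using
      convolutionAction_comp (toConv (antipode R (A := H))) (toConv .id))

lemma galoisEquiv_tmul (a b : H) : galoisEquiv R H (a ⊗ₜ b) = comul a * (1 ⊗ₜ[R] b) := by
  simp [galoisEquiv, convolutionAction_tmul _ (ℛ R a), ← (ℛ R a).eq, Finset.sum_mul]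

lemma galoisEquiv_symm_tmul {ι : Type*} {a : H} (r : Repr R a ι) (b : H) :
    (galoisEquiv R H).symm (a ⊗ₜ b) =
      ∑ i ∈ r.index, r.left i ⊗ₜ (antipode R (r.right i) * b) :=
  convolutionAction_tmul _ r b

lemma galoisEquiv_mul (h : H) (z : H ⊗[R] H) :
    galoisEquiv R H ((h ⊗ₜ 1) * z) = comul h * galoisEquiv R H z := by
  induction z with
  | zero => simp
  | add x y hx hy => simp only [mul_add, map_add, hx, hy]
  | tmul x y => simp [galoisEquiv_tmul, Bialgebra.comul_mul, mul_assoc]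

lemma galoisEquiv_symm_comul_mul (h : H) (z : H ⊗[R] H) :
    (galoisEquiv R H).symm (comul h * z) = (h ⊗ₜ 1) * (galoisEquiv R H).symm z := by
  rw [LinearEquiv.symm_apply_eq, galoisEquiv_mul, LinearEquiv.apply_symm_apply]

/-- The map `a ⊗ b ↦ φ(S(a₂) b) a₁` from `H ⊗ H` to `H`. It is `H`-linear for the action of `H` on
`H ⊗ H` through the comultiplication. -/
def contraction (φ : H →ₗ[R] R) : H ⊗[R] H →ₗ[R] H :=
  (TensorProduct.rid R H).toLinearMap ∘ₗ φ.lTensor H ∘ₗ (galoisEquiv R H).symm.toLinearMap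

lemma contraction_comul_mul (φ : H →ₗ[R] R) (h : H) (z : H ⊗[R] H) :
    contraction φ (comul h * z) = h * contraction φ z := by
  simp only [contraction, LinearMap.comp_apply, LinearEquiv.coe_coe, galoisEquiv_symm_comul_mul]
  induction (galoisEquiv R H).symm z with
  | zero => simp
  | add x y hx hy => simp only [mul_add, map_add, hx, hy]
  | tmul x y => simp

end Contraction

section Casimir

open TensorProduct

/-- The map `φ ↦ ∑ φ(xᵢ) yᵢ` from the dual of `V` to `W`, for `∑ xᵢ ⊗ yᵢ` in `V ⊗ W`. -/
def leftSlice {R V W : Type*} [CommSemiring R] [AddCommMonoid V] [Module R V] [AddCommMonoid W]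
    [Module R W] (z : V ⊗[R] W) : Module.Dual R V →ₗ[R] W where
  toFun φ := TensorProduct.lid R W (φ.rTensor W z)
  map_add' φ ψ := by simp [LinearMap.rTensor_add]
  map_smul' c φ := by simp [LinearMap.rTensor_smul]

variable {R B : Type*} [CommSemiring R] [Semiring B] [Algebra R B] {z : B ⊗[R] B}

lemma leftSlice_mul (hz : ∀ b, (b ⊗ₜ 1) * z = z * (1 ⊗ₜ b)) (φ : Module.Dual R B) (b : B) :
    leftSlice z φ * b = leftSlice z (φ ∘ₗ LinearMap.mulLeft R b) := by
  have h := congr(leftSlice $(hz b) φ)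
  obtain ⟨s, rfl⟩ := exists_finset z
  simpa [leftSlice, Finset.mul_sum, Finset.sum_mul] using h.symm

lemma mul'_comm_rTensor_eq_sum {ι : Type*} [Fintype ι] (e : Module.Basis ι R B)
    (f : B →ₗ[R] B) :
    LinearMap.mul' R B (TensorProduct.comm R B B (f.rTensor B z)) =
      ∑ i, leftSlice z (e.coord i ∘ₗ f) * e i := by
  obtain ⟨s, rfl⟩ := exists_finset z
  simp only [leftSlice, map_sum, LinearMap.rTensor_tmul, LinearMap.coe_mk, AddHom.coe_mk, comm_tmul,
    LinearMap.mul'_apply, lid_tmul, LinearMap.comp_apply, Finset.sum_mul, smul_mul_assoc]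
  rw [Finset.sum_comm]
  refine Finset.sum_congr rfl fun x _ => ?_
  conv_lhs => rw [← e.sum_repr (f x.1), Finset.mul_sum]
  simp

/-- The hypotheses force `z` to have full rank. -/
lemma exists_lTensor_eq_one_of_casimir {K B : Type*} [Field K] [Ring B] [Algebra K B]
    [FiniteDimensional K B] {z : B ⊗[K] B} (hz : ∀ b, (b ⊗ₜ 1) * z = z * (1 ⊗ₜ b))
    {f : B →ₗ[K] B} (hf : LinearMap.mul' K B (TensorProduct.comm K B B (f.rTensor B z)) = 1) :
    ∃ ν : Module.Dual K B, TensorProduct.rid K B (ν.lTensor B z) = 1 := by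
  have range_mul (φ : Module.Dual K B) (b : B) : ∃ ψ, leftSlice z ψ = leftSlice z φ * b :=
    ⟨_, (leftSlice_mul hz φ b).symm⟩
  have one_mem : (1 : B) ∈ LinearMap.range (leftSlice z) := by
    rw [← hf, mul'_comm_rTensor_eq_sum (Module.finBasis K B)]
    exact Submodule.sum_mem _ fun i _ => range_mul _ _
  have surj : Function.Surjective (leftSlice z) := fun b => by
    obtain ⟨φ, hφ⟩ := one_mem
    simpa [hφ] using range_mul φ b
  have inj : Function.Injective (leftSlice z) :=
    (LinearMap.injective_iff_surjective_of_finrank_eq_finrank Subspace.dual_finrank_eq).2 surj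
  let L := LinearEquiv.ofBijective (leftSlice z) ⟨inj, surj⟩
  let ν : Module.Dual K B := Module.Dual.eval K B 1 ∘ₗ L.symm.toLinearMap
  refine ⟨ν, Module.eval_apply_injective K (LinearMap.ext fun φ => ?_)⟩
  calc φ (TensorProduct.rid K B (ν.lTensor B z)) = ν (leftSlice z φ) := by
        obtain ⟨s, rfl⟩ := exists_finset z
        simp [leftSlice, mul_comm]
    _ = ν (L φ) := rfl
    _ = φ 1 := by simp [ν]

end Casimir

namespace LeftIntegral

open TensorProduct Coalgebra HopfAlgebra

variable {k : Type*} {H : Type*} [Field k] [Ring H] [HopfAlgebra k H] (Λ : LeftIntegral k H)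

lemma comul_mul_tmul_elt (h : H) : comul h * (1 ⊗ₜ[k] Λ.elt) = h ⊗ₜ[k] Λ.elt := by
  have counit := congrArg ((LinearMap.toSpanSingleton k H Λ.elt).lTensor H)
    (sum_tmul_counit_eq (ℛ k h))
  simp only [map_sum, LinearMap.lTensor_tmul, LinearMap.toSpanSingleton_apply, one_smul] at counit
  simpa [← (ℛ k h).eq, Finset.sum_mul, Λ.mul_elt] using counit

lemma comul_mul_elt_tmul (h b : H) : comul h * (Λ.elt ⊗ₜ[k] b) = Λ.elt ⊗ₜ[k] (h * b) := by
  conv_rhs => rw [← sum_counit_smul (ℛ k h), Finset.sum_mul, tmul_sum]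
  simp [← (ℛ k h).eq, Finset.sum_mul, Λ.mul_elt, smul_tmul]

lemma contraction_tmul_elt (φ : H →ₗ[k] k) (h : H) :
    contraction φ (h ⊗ₜ Λ.elt) = φ Λ.elt • h := by
  have : (galoisEquiv k H).symm (h ⊗ₜ Λ.elt) = h ⊗ₜ Λ.elt := by
    rw [LinearEquiv.symm_apply_eq, galoisEquiv_tmul, Λ.comul_mul_tmul_elt]
  simp [contraction, this]

lemma exists_contraction_tmul_elt :
    ∃ φ : H →ₗ[k] k, ∀ h : H, contraction φ (h ⊗ₜ Λ.elt) = h := by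
  obtain ⟨φ, hφ⟩ := Module.Projective.exists_dual_eq_one k Λ.ne_zero
  exact ⟨φ, fun h => by rw [Λ.contraction_tmul_elt, hφ, one_smul]⟩

/-- The element `Λ₁ ⊗ S(Λ₂)` of `H ⊗ H`. -/
def casimir : H ⊗[k] H := (galoisEquiv k H).symm (Λ.elt ⊗ₜ 1)

lemma tmul_one_mul_casimir (h : H) : (h ⊗ₜ 1) * Λ.casimir = Λ.casimir * (1 ⊗ₜ h) := by
  rw [casimir, ← galoisEquiv_symm_comul_mul, comul_mul_elt_tmul, galoisEquiv_symm_tmul (ℛ k _),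
    galoisEquiv_symm_tmul (ℛ k _), Finset.sum_mul]
  simp

/-- Here `f(h) = μ(h₁) S²(h₂)` with `μ(Λ) = 1`: since `S` reverses products,
`S(Λ₃) S²(Λ₂) = S(S(Λ₂) Λ₃)`. -/
lemma exists_mul'_comm_rTensor_casimir :
    ∃ f : H →ₗ[k] H,
      LinearMap.mul' k H (TensorProduct.comm k H H (f.rTensor H Λ.casimir)) = 1 := by
  obtain ⟨μ, hμ⟩ := Module.Projective.exists_dual_eq_one k Λ.ne_zero
  let f : H →ₗ[k] H := (TensorProduct.lid k H).toLinearMap ∘ₗ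
    TensorProduct.map μ (antipode k ∘ₗ antipode k) ∘ₗ comul
  let r := ℛ k Λ.elt
  have coassoc := congrArg ((TensorProduct.lid k H).toLinearMap ∘ₗ TensorProduct.map μ
      (antipode k ∘ₗ LinearMap.mul' k H ∘ₗ (antipode k).rTensor H))
    (sum_tmul_tmul_eq r (fun i => ℛ k (r.left i)) (fun i => ℛ k (r.right i)))
  have counitality := congrArg
    ((TensorProduct.lid k k).toLinearMap ∘ₗ μ.rTensor k) (sum_tmul_counit_eq r)
  simp only [map_sum, LinearMap.comp_apply, TensorProduct.map_tmul, LinearMap.rTensor_tmul,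
    LinearMap.mul'_apply, LinearEquiv.coe_coe, lid_tmul,
    antipode_mul_antidistrib, smul_eq_mul, mul_one] at coassoc counitality
  have expand (x : H) : f x = ∑ i ∈ (ℛ k x).index,
      μ ((ℛ k x).left i) • antipode k (antipode k ((ℛ k x).right i)) := by
    simp [f, ← (ℛ k x).eq]
  refine ⟨f, ?_⟩
  calc LinearMap.mul' k H (TensorProduct.comm k H H (f.rTensor H Λ.casimir))
      = ∑ i ∈ r.index, antipode k (r.right i) * f (r.left i) := by
        simp [casimir, galoisEquiv_symm_tmul r]
    _ = ∑ i ∈ r.index, μ (r.left i) • antipode k (∑ j ∈ (ℛ k (r.right i)).index,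
          antipode k ((ℛ k (r.right i)).left j) * (ℛ k (r.right i)).right j) := by
        simpa [expand, Finset.mul_sum, Finset.smul_sum, antipode_mul_antidistrib] using coassoc
    _ = (∑ i ∈ r.index, μ (r.left i) * counit (R := k) (r.right i)) • 1 := by
        simp [sum_antipode_mul_eq_smul, smul_smul, Finset.sum_smul]
    _ = 1 := by rw [counitality, hμ, one_smul]

lemma exists_contraction_elt_tmul [FiniteDimensional k H] :
    ∃ φ : H →ₗ[k] k, ∀ h : H, contraction φ (Λ.elt ⊗ₜ h) = h := by
  obtain ⟨f, hf⟩ := Λ.exists_mul'_comm_rTensor_casimir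
  obtain ⟨ν, hν⟩ := exists_lTensor_eq_one_of_casimir Λ.tmul_one_mul_casimir hf
  have contraction_one : contraction ν (Λ.elt ⊗ₜ 1) = 1 := hν
  refine ⟨ν, fun h => ?_⟩
  calc contraction ν (Λ.elt ⊗ₜ h) = contraction ν (comul h * (Λ.elt ⊗ₜ 1)) := by
        rw [comul_mul_elt_tmul, mul_one]
    _ = h := by rw [contraction_comul_mul, contraction_one, mul_one]

end LeftIntegral

/-! ### Tensor products with modules over a comodule algebra -/

open TensorProduct Coalgebra
open scoped ModuleCat

section PairAction

variable {R B A V M : Type*} [CommRing R] [Ring B] [Algebra R B] [Ring A] [Algebra R A]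
  [AddCommGroup V] [Module R V] [Module B V] [IsScalarTower R B V]
  [AddCommGroup M] [Module R M] [Module A M] [IsScalarTower R A M]

variable (B V M) in
/-- The action of `B ⊗ A` on `V ⊗ M`, for `V` a module over `B` and `M` a module over `A`. -/
def pairAction : B ⊗[R] A →ₐ[R] Module.End R (V ⊗[R] M) :=
  (Module.endTensorEndAlgHom (R := R) (S := R) (A := R) (M := V) (N := M)).comp
    (Algebra.TensorProduct.map (Algebra.lsmul R R V) (Algebra.lsmul R R M))

@[simp]
lemma pairAction_tmul (b : B) (a : A) (v : V) (m : M) :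
    pairAction B V M (b ⊗ₜ[R] a) (v ⊗ₜ[R] m) = (b • v) ⊗ₜ[R] (a • m) := by
  simp [pairAction, Module.endTensorEndAlgHom_apply]

lemma rTensor_pairAction {E B' V' : Type*} [AddCommMonoid E] [Module R E] [Ring B'] [Algebra R B']
    [AddCommGroup V'] [Module R V'] [Module B' V'] [IsScalarTower R B' V'] {α : E →ₗ[R] B}
    {β : E →ₗ[R] B'} {φ : V →ₗ[R] V'} (h : ∀ e v, φ (α e • v) = β e • φ v) (y : E ⊗[R] A)
    (x : V ⊗[R] M) :
    φ.rTensor M (pairAction B V M (α.rTensor A y) x) =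
      pairAction B' V' M (β.rTensor A y) (φ.rTensor M x) := by
  induction y with
  | zero => simp
  | add y z hy hz => simp only [map_add, LinearMap.add_apply, hy, hz]
  | tmul e a =>
    induction x with
    | zero => simp
    | add x z hx hz => simp only [map_add, hx, hz]
    | tmul v m => simp [h]

lemma lid_pairAction (y : R ⊗[R] A) (x : R ⊗[R] M) :
    TensorProduct.lid R M (pairAction R R M y x) =
      TensorProduct.lid R A y • TensorProduct.lid R M x := by
  induction y with
  | zero => simp
  | add y z hy hz => simp only [map_add, LinearMap.add_apply, add_smul, hy, hz]
  | tmul r a =>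
    induction x with
    | zero => simp
    | add x z hx hz => simp only [map_add, smul_add, hx, hz]
    | tmul s m => simp [mul_smul, smul_comm s a]

lemma assoc_symm_tmul_pairAction {B' : Type*} [Ring B'] [Algebra R B'] (b v : B') (y : B ⊗[R] A)
    (x : B ⊗[R] M) :
    (TensorProduct.assoc R B' B M).symm ((b * v) ⊗ₜ pairAction B B M y x) =
      pairAction (B' ⊗[R] B) (B' ⊗[R] B) M ((TensorProduct.assoc R B' B A).symm (b ⊗ₜ y))
        ((TensorProduct.assoc R B' B M).symm (v ⊗ₜ x)) := by
  induction y with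
  | zero => simp
  | add y z hy hz => simp only [map_add, LinearMap.add_apply, tmul_add, hy, hz]
  | tmul c a =>
    induction x with
    | zero => simp
    | add x z hx hz => simp only [map_add, tmul_add, hx, hz]
    | tmul w m => simp

end PairAction

section TensorFunctor

variable {k : Type u} {H : Type v} {A : Type u'} [Field k] [Ring H] [HopfAlgebra k H]
  [Ring A] [Algebra k A] (δ : LeftComoduleAlgebra k H A)
  {V : Type v} [AddCommGroup V] [Module k V] [Module H V] [IsScalarTower k H V]
  {M N : ModuleCat.{v} A}

variable (V M) in
/-- The `k`-module underlying the `A`-module `V ⊗ M` is the tensor product over `k`. -/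
def tensorEquiv : (tensorFunctor δ V).obj M ≃ₗ[k] V ⊗[k] M where
  toFun x := x
  invFun x := x
  left_inv _ := rfl
  right_inv _ := rfl
  map_add' _ _ := rfl
  map_smul' c x := by
    change tensorAction δ V M (algebraMap k A c) x = c • (show V ⊗[k] M from x)
    rw [AlgHom.commutes]
    rfl

lemma tensorEquiv_smul (a : A) (x : (tensorFunctor δ V).obj M) :
    tensorEquiv δ V M (a • x) = pairAction H V M (δ.coact a) (tensorEquiv δ V M x) := rfl

lemma smul_tensorEquiv_symm (a : A) (x : V ⊗[k] M) :
    a • (tensorEquiv δ V M).symm x = (tensorEquiv δ V M).symm (pairAction H V M (δ.coact a) x) :=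
  rfl

lemma map_tensorEquiv_symm (f : M ⟶ N) (x : V ⊗[k] M) :
    (tensorFunctor δ V).map f ((tensorEquiv δ V M).symm x) =
      (tensorEquiv δ V N).symm ((f.hom.restrictScalars k).lTensor V x) := rfl

variable {δ} in
lemma tensorFunctor_hom_ext {f g : (tensorFunctor δ V).obj M ⟶ N}
    (h : ∀ v m, f ((tensorEquiv δ V M).symm (v ⊗ₜ m)) = g ((tensorEquiv δ V M).symm (v ⊗ₜ m))) :
    f = g := by
  ext x
  obtain ⟨x, rfl⟩ := (tensorEquiv δ V M).symm.surjective x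
  induction x with
  | zero => simp
  | add y z hy hz => simp only [map_add, hy, hz]
  | tmul v m => exact h v m

lemma shortExact_map_tensorFunctor {S : ShortComplex (ModuleCat.{v} A)} (hS : S.ShortExact) :
    (S.map (tensorFunctor δ V)).ShortExact := by
  have hf := (ModuleCat.mono_iff_injective _).1 hS.mono_f
  have hg := (ModuleCat.epi_iff_surjective _).1 hS.epi_g
  have hfg := (ShortComplex.ShortExact.moduleCat_exact_iff_function_exact S).1 hS.exact
  exact
    { exact := (ShortComplex.ShortExact.moduleCat_exact_iff_function_exact _).2
        (lTensor_exact V (f := S.f.hom.restrictScalars k) (g := S.g.hom.restrictScalars k) hfg hg)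
      mono_f := (ModuleCat.mono_iff_injective _).2
        (Module.Flat.lTensor_preserves_injective_linearMap (M := V)
          (S.f.hom.restrictScalars k) hf)
      epi_g := (ModuleCat.epi_iff_surjective _).2
        (LinearMap.lTensor_surjective V (g := S.g.hom.restrictScalars k) hg) }

variable (M) in
/-- The identification of the `A`-module `H ⊗ (H ⊗ M)` with the `k`-module `(H ⊗ H) ⊗ M`. -/
def doubleEquiv : (tensorFunctor δ H).obj ((tensorFunctor δ H).obj M) ≃ₗ[k] (H ⊗[k] H) ⊗[k] M :=
  tensorEquiv δ H _ ≪≫ₗ (tensorEquiv δ H M).lTensor H ≪≫ₗ (TensorProduct.assoc k H H M).symm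

lemma doubleEquiv_tensorEquiv_symm (g : H) (x : H ⊗[k] M) :
    doubleEquiv δ M ((tensorEquiv δ H _).symm (g ⊗ₜ (tensorEquiv δ H M).symm x)) =
      (TensorProduct.assoc k H H M).symm (g ⊗ₜ x) := by
  simp [doubleEquiv]

lemma doubleEquiv_symm_tmul (g g' : H) (m : M) :
    (doubleEquiv δ M).symm ((g ⊗ₜ g') ⊗ₜ m) =
      (tensorEquiv δ H _).symm (g ⊗ₜ (tensorEquiv δ H M).symm (g' ⊗ₜ m)) := by
  rw [LinearEquiv.symm_apply_eq, doubleEquiv_tensorEquiv_symm, assoc_symm_tmul]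

lemma doubleEquiv_smul (a : A) (x : (tensorFunctor δ H).obj ((tensorFunctor δ H).obj M)) :
    doubleEquiv δ M (a • x) =
      pairAction (H ⊗[k] H) (H ⊗[k] H) M (comul.rTensor A (δ.coact a)) (doubleEquiv δ M x) := by
  obtain ⟨x, rfl⟩ := (tensorEquiv δ H _).symm.surjective x
  have coassoc : comul.rTensor A (δ.coact a) = (TensorProduct.assoc k H H A).symm
      (δ.coact.toLinearMap.lTensor H (δ.coact a)) := by
    rw [← δ.coassoc, LinearEquiv.symm_apply_apply]
  rw [coassoc, smul_tensorEquiv_symm]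
  induction δ.coact a with
  | zero => simp
  | add y z hy hz => simp only [map_add, LinearMap.add_apply, hy, hz]
  | tmul h b =>
    induction x with
    | zero => simp
    | add y z hy hz => simp only [map_add, hy, hz]
    | tmul g x =>
      obtain ⟨x, rfl⟩ := (tensorEquiv δ H M).symm.surjective x
      rw [pairAction_tmul, smul_tensorEquiv_symm, doubleEquiv_tensorEquiv_symm,
        doubleEquiv_tensorEquiv_symm, smul_eq_mul, assoc_symm_tmul_pairAction]
      rfl

/-- The morphism of `A`-modules given by a `k`-linear map compatible with the actions of `A`. -/
def ofLinearMap (f : M →ₗ[k] N) (hf : ∀ (a : A) x, f (a • x) = a • f x) : M ⟶ N :=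
  ModuleCat.ofHom { f with map_smul' := hf }

@[simp]
lemma ofLinearMap_apply (f : M →ₗ[k] N) (hf : ∀ (a : A) x, f (a • x) = a • f x) (x : M) :
    ofLinearMap f hf x = f x := rfl

variable (M) in
/-- The `A`-linear map `H ⊗ (H ⊗ M) → H ⊗ M` induced by an `H`-linear map `H ⊗ H → H`. -/
def foldMap (φ : H ⊗[k] H →ₗ[k] H) (hφ : ∀ h z, φ (comul h * z) = h * φ z) :
    (tensorFunctor δ H).obj ((tensorFunctor δ H).obj M) ⟶ (tensorFunctor δ H).obj M :=
  ofLinearMap ((tensorEquiv δ H M).symm.toLinearMap ∘ₗ φ.rTensor M ∘ₗ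
    (doubleEquiv δ M).toLinearMap) fun a x => by
      have h := rTensor_pairAction (M := M) (α := comul) (β := .id) (φ := φ) hφ (δ.coact a)
        (doubleEquiv δ M x)
      simpa [doubleEquiv_smul, smul_tensorEquiv_symm] using h

variable (M) in
/-- The `A`-linear map `H ⊗ M → H ⊗ (H ⊗ M)` induced by the comultiplication of `H`. -/
def comulMap : (tensorFunctor δ H).obj M ⟶
    (tensorFunctor δ H).obj ((tensorFunctor δ H).obj M) :=
  ofLinearMap ((doubleEquiv δ M).symm.toLinearMap ∘ₗ comul.rTensor M ∘ₗ
    (tensorEquiv δ H M).toLinearMap) fun a x => by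
      have h := rTensor_pairAction (M := M) (α := .id) (β := comul) (φ := comul)
        (Bialgebra.comul_mul (R := k) (A := H)) (δ.coact a) (tensorEquiv δ H M x)
      simpa [LinearEquiv.symm_apply_eq, doubleEquiv_smul, tensorEquiv_smul] using h

variable (M) in
/-- The `A`-linear map `H ⊗ M → M` induced by the counit of `H`. -/
def counitMap : (tensorFunctor δ H).obj M ⟶ M :=
  ofLinearMap ((TensorProduct.lid k M).toLinearMap ∘ₗ counit.rTensor M ∘ₗ
    (tensorEquiv δ H M).toLinearMap) fun a x => by
      have h := rTensor_pairAction (M := M) (α := .id) (β := counit) (φ := counit)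
        (Bialgebra.counit_mul (R := k) (A := H)) (δ.coact a) (tensorEquiv δ H M x)
      simp only [LinearMap.rTensor_id, LinearMap.id_coe, id_eq] at h
      simp only [LinearMap.comp_apply, LinearEquiv.coe_coe, tensorEquiv_smul, h, lid_pairAction,
        δ.counit_coact]

instance : Epi (counitMap δ M) :=
  (ModuleCat.epi_iff_surjective _).2 fun m =>
    ⟨(tensorEquiv δ H M).symm (1 ⊗ₜ m), by simp [counitMap]⟩

lemma counitMap_naturality (f : M ⟶ N) :
    (tensorFunctor δ H).map f ≫ counitMap δ N = counitMap δ M ≫ f :=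
  tensorFunctor_hom_ext fun h m => by simp [counitMap, map_tensorEquiv_symm]

lemma comulMap_counitMap : comulMap δ M ≫ counitMap δ _ = 𝟙 _ :=
  tensorFunctor_hom_ext fun g m => by
    have key (w : H ⊗[k] H) : counitMap δ _ ((doubleEquiv δ M).symm (w ⊗ₜ m)) =
        (tensorEquiv δ H M).symm (TensorProduct.lid k H (counit.rTensor H w) ⊗ₜ m) := by
      induction w with
      | zero => simp
      | add y z hy hz => simp only [map_add, add_tmul, hy, hz]
      | tmul h h' =>
        rw [doubleEquiv_symm_tmul]
        simp [counitMap, ← smul_tmul']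
    simp [comulMap, key]

lemma comulMap_map_counitMap : comulMap δ M ≫ (tensorFunctor δ H).map (counitMap δ M) = 𝟙 _ :=
  tensorFunctor_hom_ext fun g m => by
    have key (w : H ⊗[k] H) :
        (tensorFunctor δ H).map (counitMap δ M) ((doubleEquiv δ M).symm (w ⊗ₜ m)) =
        (tensorEquiv δ H M).symm (TensorProduct.rid k H (counit.lTensor H w) ⊗ₜ m) := by
      induction w with
      | zero => simp
      | add y z hy hz => simp only [map_add, add_tmul, hy, hz]
      | tmul h h' =>
        rw [doubleEquiv_symm_tmul, map_tensorEquiv_symm]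
        simp [counitMap, smul_tmul]
    simp [comulMap, key]

variable (Λ : LeftIntegral k H)

lemma unitMap_apply (m : M) :
    unitMap (δ := δ) Λ M m = (tensorEquiv δ H M).symm (Λ.elt ⊗ₜ m) := rfl

lemma unitMap_naturality (f : M ⟶ N) :
    f ≫ unitMap (δ := δ) Λ N = unitMap (δ := δ) Λ M ≫ (tensorFunctor δ H).map f := rfl

lemma quotMap_naturality (f : M ⟶ N) :
    (tensorFunctor δ H).map f ≫ quotMap Λ N = quotMap (δ := δ) Λ M ≫ (shiftT δ Λ).map f :=
  tensorFunctor_hom_ext fun _ _ => rfl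

variable {Λ} in
lemma unitMap_foldMap {φ : H ⊗[k] H →ₗ[k] H} (hφ : ∀ h z, φ (comul h * z) = h * φ z)
    (h : ∀ h, φ (Λ.elt ⊗ₜ h) = h) :
    unitMap (δ := δ) Λ _ ≫ foldMap δ M φ hφ = 𝟙 _ :=
  tensorFunctor_hom_ext fun g m => by
    simp [unitMap_apply, foldMap, doubleEquiv_tensorEquiv_symm, h]

variable {Λ} in
lemma map_unitMap_foldMap {φ : H ⊗[k] H →ₗ[k] H} (hφ : ∀ h z, φ (comul h * z) = h * φ z)
    (h : ∀ h, φ (h ⊗ₜ Λ.elt) = h) :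
    (tensorFunctor δ H).map (unitMap Λ M) ≫ foldMap δ M φ hφ = 𝟙 _ :=
  tensorFunctor_hom_ext fun g m => by
    have key : (tensorFunctor δ H).map (unitMap Λ M) ((tensorEquiv δ H M).symm (g ⊗ₜ m)) =
        (doubleEquiv δ M).symm ((g ⊗ₜ Λ.elt) ⊗ₜ m) := by
      rw [doubleEquiv_symm_tmul]
      rfl
    simp [key, foldMap, h]

lemma exact_toSpanSingleton_mkQ :
    Function.Exact (LinearMap.toSpanSingleton k H Λ.elt) (Λ.line.mkQ.restrictScalars k) :=
  fun _ => (Submodule.Quotient.mk_eq_zero _).trans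
    ⟨fun ⟨c, hc⟩ => ⟨c, hc.symm⟩, fun ⟨c, hc⟩ => ⟨c, hc.symm⟩⟩

lemma unitMap_eq_rTensor (m : M) : unitMap (δ := δ) Λ M m = (tensorEquiv δ H M).symm
    ((LinearMap.toSpanSingleton k H Λ.elt).rTensor M ((TensorProduct.lid k M).symm m)) := by
  simp [unitMap_apply]

lemma injective_unitMap : Function.Injective (unitMap (δ := δ) Λ M) := fun m m' h => by
  rw [unitMap_eq_rTensor, unitMap_eq_rTensor] at h
  have hΛ : Function.Injective (LinearMap.toSpanSingleton k H Λ.elt) :=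
    LinearMap.ker_eq_bot.1 (LinearMap.ker_toSpanSingleton k Λ.ne_zero)
  exact (TensorProduct.lid k M).symm.injective
    (Module.Flat.rTensor_preserves_injective_linearMap _ hΛ
      ((tensorEquiv δ H M).symm.injective h))

lemma exact_unitMap_quotMap :
    Function.Exact (unitMap (δ := δ) Λ M) (quotMap (δ := δ) Λ M) := fun x => by
  refine (rTensor_exact M (exact_toSpanSingleton_mkQ Λ) Λ.line.mkQ_surjective
    (tensorEquiv δ H M x)).trans
    ((TensorProduct.lid k M).symm.surjective.exists.trans (exists_congr fun m => ?_))
  rw [unitMap_eq_rTensor, LinearEquiv.symm_apply_eq]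

lemma shortExact_unitMap_quotMap (M : ModuleCat.{v} A) :
    (ShortComplex.mk _ _ (unitMap_quotMap δ Λ M)).ShortExact where
  exact := (ShortComplex.ShortExact.moduleCat_exact_iff_function_exact _).2
    (exact_unitMap_quotMap δ Λ)
  mono_f := (ModuleCat.mono_iff_injective _).2 (injective_unitMap δ Λ)
  epi_g := (ModuleCat.epi_iff_surjective _).2
    (LinearMap.rTensor_surjective M (g := Λ.line.mkQ.restrictScalars k) Λ.line.mkQ_surjective)

end TensorFunctor

/-! ### The triangulation of the stable category -/

section StableCategory

variable {k : Type u} {H : Type v} {A : Type u'} [Field k] [Ring H] [HopfAlgebra k H]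
  [Ring A] [Algebra k A] (δ : LeftComoduleAlgebra k H A)
  [FiniteDimensional k H] (Λ : LeftIntegral k H)

/-- The relative Frobenius structure on modules over a comodule algebra given by `H ⊗ -`. -/
def relativeFrobenius : RelativeFrobenius (ModuleCat.{v} A) where
  I := tensorFunctor δ H
  T := shiftT δ Λ
  additive := inferInstance
  shortExact_map := shortExact_map_tensorFunctor δ
  ι := unitMap Λ
  q := quotMap Λ
  ε M := counitMap δ M
  ι_naturality := unitMap_naturality δ Λ
  q_naturality := quotMap_naturality δ Λ
  ε_naturality := counitMap_naturality δ
  ι_q := unitMap_quotMap δ Λ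
  shortExact := shortExact_unitMap_quotMap δ Λ
  epi_ε := inferInstance
  isSplitMono_ι M := by
    obtain ⟨φ, hφ⟩ := Λ.exists_contraction_elt_tmul
    exact .mk' ⟨_, unitMap_foldMap δ (contraction_comul_mul φ) hφ⟩
  isSplitMono_map_ι M := by
    obtain ⟨φ, hφ⟩ := Λ.exists_contraction_tmul_elt
    exact .mk' ⟨_, map_unitMap_foldMap δ (contraction_comul_mul φ) hφ⟩
  isSplitEpi_ε M := .mk' ⟨_, comulMap_counitMap δ⟩
  isSplitEpi_map_ε M := .mk' ⟨_, comulMap_map_counitMap δ⟩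

lemma isStableQuotient : (relativeFrobenius δ Λ).IsStableQuotient (toStable δ) where
  additive := inferInstance
  full := inferInstanceAs (CategoryTheory.Quotient.functor (homotopyRel δ)).Full
  essSurj := inferInstanceAs (CategoryTheory.Quotient.functor (homotopyRel δ)).EssSurj
  map_eq_zero_iff f := by
    rw [← (toStable δ).map_zero]
    refine (CategoryTheory.Quotient.functor_map_eq_iff (homotopyRel δ) f 0).trans ?_
    change NullHomotopic δ (f - 0) ↔ NullHomotopic δ f
    rw [sub_zero]

/-- The endofunctor of the stable category induced by `T`. -/
def stableShift : StableCat δ ⥤ StableCat δ :=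
  CategoryTheory.Quotient.lift (homotopyRel δ) (shiftT δ Λ ⋙ toStable δ) fun X Y f g h => by
    have hT : (relativeFrobenius δ Λ).Null ((relativeFrobenius δ Λ).T.map (f - g)) :=
      RelativeFrobenius.Null.map_T h
    exact (isStableQuotient δ Λ).map_eq_map_iff.2 (by rwa [Functor.map_sub] at hT)

/-- The commutation of `T` and the endofunctor it induces with the projection to the stable
category. -/
def toStableCompStableShift : toStable δ ⋙ stableShift δ Λ ≅ shiftT δ Λ ⋙ toStable δ :=
  CategoryTheory.Quotient.lift.isLift _ _ _

instance : (stableShift δ Λ).IsEquivalence :=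
  (isStableQuotient δ Λ).isEquivalence (toStableCompStableShift δ Λ)

instance : (stableShift δ Λ).Additive := by
  have := (isStableQuotient δ Λ).full
  have := (isStableQuotient δ Λ).essSurj
  have : (shiftT δ Λ).Additive := inferInstanceAs (tensorFunctor δ _).Additive
  have : (toStable δ ⋙ stableShift δ Λ).Additive :=
    Functor.additive_of_iso (toStableCompStableShift δ Λ).symm
  exact Functor.additive_of_full_essSurj_comp (toStable δ) _

end StableCategory

end Hopfological

end

theorem mainTheorem1 {k : Type u} {H : Type v} {A : Type u'} [Field k] [Ring H] [HopfAlgebra k H]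
    [FiniteDimensional k H] [Ring A] [Algebra k A]
    (δ : LeftComoduleAlgebra k H A) (Λ : LeftIntegral k H) :
    ∃ (_ : HasShift (StableCat δ) ℤ)
      (_ : ∀ n : ℤ, (shiftFunctor (StableCat δ) n).Additive)
      (e : toStable δ ⋙ shiftFunctor (StableCat δ) (1 : ℤ) ≅ shiftT δ Λ ⋙ toStable δ)
      (P : Pretriangulated (StableCat δ)),
      (∀ t : Triangle (StableCat δ), t ∈ P.distinguishedTriangles ↔
        ∃ (X Y : ModuleCat.{v} A) (u : X ⟶ Y), Nonempty (t ≅ standardTriangle δ Λ u e)) ∧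
      IsTriangulated (StableCat δ) := by
  let hs : HasShift (StableCat δ) ℤ := hasShiftOfIsEquivalence (stableShift δ Λ)
  let i : shiftFunctor (StableCat δ) (1 : ℤ) ≅ stableShift δ Λ :=
    shiftFunctorOneIso (stableShift δ Λ)
  have hadd : ∀ n : ℤ, (shiftFunctor (StableCat δ) n).Additive :=
    additive_shiftFunctor_of_one (Functor.additive_of_iso i.symm)
  let e : toStable δ ⋙ shiftFunctor (StableCat δ) (1 : ℤ) ≅ shiftT δ Λ ⋙ toStable δ :=
    Functor.isoWhiskerLeft (toStable δ) i ≪≫ toStableCompStableShift δ Λ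
  exact ⟨hs, hadd, e, ((isStableQuotient δ Λ).isRightTriangulation e).pretriangulated,
    fun _ => Iff.rfl, (isStableQuotient δ Λ).isTriangulated⟩
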